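/- Let $p$ be a prime, $k\ge 2$ an integer, and let $|\cdot|_p$ be the absolute value on $\overline{\mathbb Q_p}$ with $|p|_p=p^{-1}$. Let $F_n$ be the free pro-$p$ group on $g_1,\dots,g_n$, let $r_1,\dots,r_m\in F_n$, and let $G=\langle g_1,\dots,g_n\mid r_1=\dots=r_m=1\rangle^{\text{pro-}p}$ be the quotient of $F_n$ by the closed normal subgroup generated by the $r_j$, with projection $\pi\colon F_n\to G$. Let $\Gamma=\mathbb Z_p$ (written multiplicatively) and let $\alpha\colon G\to\Gamma$ be a continuous surjective homomorphism with $\alpha(\pi(g_i))=\gamma$ for all $i$; then $\gamma$ is a topological generator of $\Gamma$ and every relator $r_j$ has total degree $0$. Let $\varphi_{k-2}\colon F_n\to \mathrm{GL}(k-1;\overline{\mathbb Q_p})$ be a continuous homomorphism and put $$\widetilde{\varphi_{k-2}}:=\varphi_{k-2}\otimes(\alpha\circ\pi)\colon F_n\to \mathrm{GL}(k-1;\overline{\mathbb Q_p}\otimes_{\mathbb Z_p}\mathbb Z_p[[\Gamma]]),\qquad \widetilde{\varphi_{k-2}}(x)=\varphi_{k-2}(x)\cdot(\alpha\circ\pi)(x),$$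 extended to a continuous $\mathbb Z_p$-algebra homomorphism on $\mathbb Z_p[[F_n]]$. Let $\partial/\partial g_i$ be the pro-$p$ Fox derivatives, let $$Q=\left(\widetilde{\varphi_{k-2}}\left(\frac{\partial r_j}{\partial g_i}\right)\right)\in \mathrm M\bigl(m(k-1),n(k-1);\overline{\mathbb Q_p}\otimes_{\mathbb Z_p}\mathbb Z_p[[\Gamma]]\bigr),$$ and let the arithmetic twisted Alexander polynomial $\Delta_{k-1}(A_{\widetilde{\varphi_{k-2}}})\in\overline{\mathbb Q_p}\otimes_{\mathbb Z_p}\mathbb Z_p[[\Gamma]]$ be a greatest common divisor (unique up to units) of the ideal generated by the minors of $Q$ of size $n(k-1)-(k-1)$ (this ideal is $0$ if $n(k-1)-(k-1)>m(k-1)$). Let $a_{k-1}\in\overline{\mathbb Q_p}^{\times}$ with $|a_{k-1}-1|_p<1$, and let $|_{\gamma=a_{k-1}}$ be the $\overline{\mathbb Q_p}$-algebra homomorphism $\overline{\mathbb Q_p}\otimes_{\mathbb Z_p}\mathbb Z_p[[\Gamma]]\to\overline{\mathbb Q_p}$ that is continuous on $\mathbb Z_p[[\Gamma]]$ and sends $\gamma$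 to $a_{k-1}$. Let $\rho_{k-2}\colon G\to\mathrm{GL}(k-1;\overline{\mathbb Q_p})$ be a continuous representation with $\rho_{k-2}\circ\pi=\widetilde{\varphi_{k-2}}|_{\gamma=a_{k-1}}$. If $a_{k-1}$ is a zero of $\Delta_{k-1}(A_{\widetilde{\varphi_{k-2}}})$, that is, if $\Delta_{k-1}(A_{\widetilde{\varphi_{k-2}}})|_{\gamma=a_{k-1}}=0$, then the first continuous cohomology group $$H^1\bigl(G,(\overline{\mathbb Q_p}^{\oplus(k-1)})_{\rho_{k-2}}\bigr)=Z^1/B^1$$ is nonzero, where $Z^1$ is the space of continuous maps $\beta\colon G\to\overline{\mathbb Q_p}^{\oplus(k-1)}$ with $\beta(xy)=\beta(x)+\rho_{k-2}(x)\beta(y)$ for all $x,y\in G$, and $B^1\subset Z^1$ is the subspace of the maps $x\mapsto\rho_{k-2}(x)v-v$ with $v\in\overline{\mathbb Q_p}^{\oplus(k-1)}$. -/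

import Mathlib

open scoped TensorProduct

noncomputable section

/-! ### The free pro-`p` group of finite rank -/

/-- The normal subgroups of `p`-power index of the (discrete) free group on `n` letters. -/
abbrev PPowerQuotientIndex (p n : ℕ) : Type :=
  {N : Subgroup (FreeGroup (Fin n)) // N.Normal ∧ ∃ e : ℕ, N.index = p ^ e}

instance PPowerQuotientIndex.instNormal {p n : ℕ} (N : PPowerQuotientIndex p n) : N.1.Normal :=
  N.2.1

/-- The free pro-`p` group `F_n` on `n` generators: the inverse limit of the quotients of the
discrete free group by its normal subgroups of `p`-power index. -/
def freeProPSubgroup (p n : ℕ) :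
    Subgroup (∀ N : PPowerQuotientIndex p n, FreeGroup (Fin n) ⧸ N.1) where
  carrier := {x | ∀ (N M : PPowerQuotientIndex p n) (h : N.1 ≤ M.1),
    QuotientGroup.map N.1 M.1 (MonoidHom.id _) h (x N) = x M}
  one_mem' := fun N M h => map_one _
  mul_mem' := fun {x y} hx hy N M h => by
    rw [Pi.mul_apply, map_mul, hx N M h, hy N M h, Pi.mul_apply]
  inv_mem' := fun {x} hx N M h => by
    rw [Pi.inv_apply, map_inv, hx N M h, Pi.inv_apply]

/-- The underlying type of the free pro-`p` group on `n` generators. -/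
def FreeProP (p n : ℕ) : Type := freeProPSubgroup p n

namespace FreeProP

instance instGroup (p n : ℕ) : Group (FreeProP p n) :=
  inferInstanceAs (Group (freeProPSubgroup p n))

/-- The inverse limit topology, every finite quotient being discrete. -/
instance instTopologicalSpace (p n : ℕ) : TopologicalSpace (FreeProP p n) :=
  TopologicalSpace.induced (fun x : freeProPSubgroup p n => x.1)
    (@Pi.topologicalSpace _ _ fun _ => ⊥)

/-- The free generators `g_1, …, g_n` of `F_n`. -/
def gen (p : ℕ) {n : ℕ} (i : Fin n) : FreeProP p n :=
  ⟨fun _ => QuotientGroup.mk (FreeGroup.of i), fun _ _ _ => rfl⟩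

end FreeProP

/-! ### Complete group algebras -/

section CompleteGroupAlgebra

/-- The projection `H/U → H/V` for open normal subgroups `U ≤ V`. -/
def openQuotientMap {H : Type*} [Group H] [TopologicalSpace H] {U V : OpenNormalSubgroup H}
    (h : U.toSubgroup ≤ V.toSubgroup) : H ⧸ U.toSubgroup →* H ⧸ V.toSubgroup :=
  QuotientGroup.map U.toSubgroup V.toSubgroup (MonoidHom.id H)
    (h.trans (Subgroup.comap_id V.toSubgroup).ge)

variable (p : ℕ) [Fact p.Prime] (H : Type*) [Group H] [TopologicalSpace H]

/-- The complete group algebra `ℤ_p[[H]]` of a profinite group `H`: the inverse limit of the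
group algebras `ℤ_p[H/U]` over the open normal subgroups `U` of `H`. -/
def completeGroupSubalgebra :
    Subalgebra ℤ_[p] (∀ U : OpenNormalSubgroup H, MonoidAlgebra ℤ_[p] (H ⧸ U.toSubgroup)) where
  carrier := {x | ∀ (U V : OpenNormalSubgroup H) (h : U.toSubgroup ≤ V.toSubgroup),
    MonoidAlgebra.mapDomainAlgHom ℤ_[p] ℤ_[p] (openQuotientMap h) (x U) = x V}
  mul_mem' := fun {x y} hx hy U V h => by
    rw [Pi.mul_apply, map_mul, hx U V h, hy U V h, Pi.mul_apply]
  add_mem' := fun {x y} hx hy U V h => by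
    rw [Pi.add_apply, map_add, hx U V h, hy U V h, Pi.add_apply]
  algebraMap_mem' := fun c U V h => by
    rw [Pi.algebraMap_apply, AlgHom.commutes, Pi.algebraMap_apply]

/-- The underlying type of the complete group algebra `ℤ_p[[H]]`. -/
def CompleteGroupAlgebra : Type _ := completeGroupSubalgebra p H

namespace CompleteGroupAlgebra

instance instRing : Ring (CompleteGroupAlgebra p H) :=
  inferInstanceAs (Ring (completeGroupSubalgebra p H))

instance instAlgebra : Algebra ℤ_[p] (CompleteGroupAlgebra p H) :=
  inferInstanceAs (Algebra ℤ_[p] (completeGroupSubalgebra p H))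

variable {H}

/-- The projection `ℤ_p[[H]] → ℤ_p[H/U]`. -/
def proj (U : OpenNormalSubgroup H) :
    CompleteGroupAlgebra p H →ₐ[ℤ_[p]] MonoidAlgebra ℤ_[p] (H ⧸ U.toSubgroup) where
  toFun x := x.1 U
  map_one' := rfl
  map_mul' _ _ := rfl
  map_zero' := rfl
  map_add' _ _ := rfl
  commutes' _ := rfl

variable {p} in
theorem ext_proj {x y : CompleteGroupAlgebra p H} (h : ∀ U, proj p U x = proj p U y) : x = y :=
  Subtype.ext (funext h)

/-- The inverse limit topology, where each `ℤ_p[H/U]` carries the `p`-adic topology of its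
coefficients. -/
instance instTopologicalSpace : TopologicalSpace (CompleteGroupAlgebra p H) :=
  TopologicalSpace.induced
    (fun (x : CompleteGroupAlgebra p H) (U : OpenNormalSubgroup H)
      (c : H ⧸ U.toSubgroup) => (proj p U x).coeff c)
    inferInstance

/-- The canonical map `H → ℤ_p[[H]]`. -/
def of : H →* CompleteGroupAlgebra p H where
  toFun x := ⟨fun U => MonoidAlgebra.of ℤ_[p] (H ⧸ U.toSubgroup) (QuotientGroup.mk x),
    fun U V h => by
      simp only [MonoidAlgebra.mapDomainAlgHom_apply, MonoidAlgebra.of_apply,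
        MonoidAlgebra.mapDomain_single]
      rfl⟩
  map_one' := ext_proj fun U => (map_one (MonoidAlgebra.of ℤ_[p] (H ⧸ U.toSubgroup)))
  map_mul' x y := ext_proj fun U =>
    map_mul (MonoidAlgebra.of ℤ_[p] (H ⧸ U.toSubgroup)) (QuotientGroup.mk x) (QuotientGroup.mk y)

end CompleteGroupAlgebra

/-- The complete group algebra of a commutative group is commutative. -/
instance CompleteGroupAlgebra.instCommRing (H : Type*) [CommGroup H] [TopologicalSpace H] :
    CommRing (CompleteGroupAlgebra p H) :=
  { CompleteGroupAlgebra.instRing p H with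
    mul_comm := fun x y => CompleteGroupAlgebra.ext_proj fun U => by
      rw [map_mul, map_mul, mul_comm] }

end CompleteGroupAlgebra

/-! ### Pro-`p` Fox derivatives -/

/-- The pro-`p` Fox derivative `∂/∂g_i`, restricted to group elements: the unique continuous map
`D : F_n → ℤ_p[[F_n]]` with `D(g_j) = δ_{ij}` and `D(xy) = D(x) + x D(y)`. -/
def foxDerivative (p : ℕ) [Fact p.Prime] {n : ℕ} (i : Fin n) :
    FreeProP p n → CompleteGroupAlgebra p (FreeProP p n) := by
  classical
  exact
    if h : ∃ D : FreeProP p n → CompleteGroupAlgebra p (FreeProP p n), Continuous D ∧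
        (∀ j, D (FreeProP.gen p j) = if j = i then 1 else 0) ∧
        ∀ x y, D (x * y) = D x + CompleteGroupAlgebra.of p x * D y
    then h.choose else 0

/-! ### The tensor product representation and its specializations -/

section Twist

variable (p : ℕ) [Fact p.Prime]

/-- The group `Γ = ℤ_p`, written multiplicatively. -/
abbrev Gam : Type := Multiplicative ℤ_[p]

/-- The ring `Q̄_p ⊗_{ℤ_p} ℤ_p[[Γ]]`. -/
abbrev IwasawaTensor : Type := PadicAlgCl p ⊗[ℤ_[p]] CompleteGroupAlgebra p (Gam p)

variable {p}

/-- Evaluation `|_{γ = a}`: the unique `Q̄_p`-algebra homomorphism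
`Q̄_p ⊗ ℤ_p[[Γ]] → Q̄_p` that is continuous on `ℤ_p[[Γ]]` and sends the topological
generator `γ` of `Γ` to `a` (it exists for `|a - 1|_p < 1`). -/
def evalAt (γ : Gam p) (a : PadicAlgCl p) : IwasawaTensor p → PadicAlgCl p := by
  classical
  exact
    if h : ∃ ev : IwasawaTensor p →ₐ[PadicAlgCl p] PadicAlgCl p,
        Continuous (fun c : CompleteGroupAlgebra p (Gam p) => ev (1 ⊗ₜ[ℤ_[p]] c)) ∧
        ev (1 ⊗ₜ[ℤ_[p]] CompleteGroupAlgebra.of p γ) = a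
    then h.choose else 0

/-- Continuity of a map from a compact space into `Q̄_p ⊗ ℤ_p[[Γ]]`: it takes its values in a
finitely generated `ℤ_p[[Γ]]`-submodule `∑ e_i ⊗ ℤ_p[[Γ]]`, through continuous coordinates. -/
def ContinuousIntoTensor {X : Type*} [TopologicalSpace X] (f : X → IwasawaTensor p) : Prop :=
  ∃ (s : ℕ) (e : Fin s → PadicAlgCl p) (c : Fin s → X → CompleteGroupAlgebra p (Gam p)),
    (∀ i, Continuous (c i)) ∧ ∀ x, f x = ∑ i, e i ⊗ₜ[ℤ_[p]] c i x

variable {F : Type*} [Group F] [TopologicalSpace F] {l : ℕ}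

/-- The tensor product representation `φ̃ = φ ⊗ χ`, `φ̃(x) = φ(x) · χ(x)`, with values in the
matrices over `Q̄_p ⊗ ℤ_p[[Γ]]`. -/
def twist (φ : F →ₜ* GL (Fin l) (PadicAlgCl p)) (χ : F →ₜ* Gam p) (x : F) :
    Matrix (Fin l) (Fin l) (IwasawaTensor p) :=
  (φ x : Matrix (Fin l) (Fin l) (PadicAlgCl p)).map
    fun c => c ⊗ₜ[ℤ_[p]] CompleteGroupAlgebra.of p (χ x)

/-- The extension of `φ̃ = φ ⊗ χ` to the complete group algebra: the unique continuous
`ℤ_p`-algebra homomorphism `ℤ_p[[F]] → M_l(Q̄_p ⊗ ℤ_p[[Γ]])` that extends `φ̃`. -/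
def completeTwist (φ : F →ₜ* GL (Fin l) (PadicAlgCl p)) (χ : F →ₜ* Gam p) :
    CompleteGroupAlgebra p F → Matrix (Fin l) (Fin l) (IwasawaTensor p) := by
  classical
  exact
    if h : ∃ Φ : CompleteGroupAlgebra p F →ₐ[ℤ_[p]] Matrix (Fin l) (Fin l) (IwasawaTensor p),
        (∀ x, Φ (CompleteGroupAlgebra.of p x) = twist φ χ x) ∧
        ∀ s t, ContinuousIntoTensor fun z => Φ z s t
    then h.choose else 0

/-- The presentation matrix `Q_φ̃ = (φ̃(∂r_j/∂g_i))`, of size `ml × nl`. -/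
def foxMatrix {n m : ℕ} (r : Fin m → FreeProP p n)
    (φ : FreeProP p n →ₜ* GL (Fin l) (PadicAlgCl p)) (χ : FreeProP p n →ₜ* Gam p) :
    Matrix (Fin m × Fin l) (Fin n × Fin l) (IwasawaTensor p) :=
  Matrix.of fun js it => completeTwist φ χ (foxDerivative p it.1 (r js.1)) js.2 it.2

end Twist

/-! ### Fitting ideals and greatest common divisors -/

/-- The `d`-th Fitting ideal of the module presented by `Q` (the columns of `Q` correspond to the
generators): the ideal generated by the minors of `Q` of size `(number of columns) - d`.
It is zero if there are fewer rows than that. -/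
def fittingIdeal {R : Type*} [CommRing R] {ι κ : Type*} [Fintype κ]
    (Q : Matrix ι κ R) (d : ℕ) : Ideal R :=
  Ideal.span {x | ∃ (f : Fin (Fintype.card κ - d) ↪ ι) (g : Fin (Fintype.card κ - d) ↪ κ),
    x = (Q.submatrix f g).det}

/-- `Δ` is a greatest common divisor of the elements (equivalently, of any set of generators)
of the ideal `I`. -/
def IsGCDOfIdeal {R : Type*} [CommRing R] (Δ : R) (I : Ideal R) : Prop :=
  ∀ c : R, c ∣ Δ ↔ ∀ x ∈ I, c ∣ x

/-- `Δ` is the `d`-th invariant `Δ_d(A_φ̃)`, a greatest common divisor of the `d`-th Fitting ideal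
`E_d(A_φ̃)`; for `φ` of degree `k - 1` and `d = k - 1` this is the arithmetic twisted Alexander
polynomial. It is determined up to units. -/
def IsTwistedAlexander {p : ℕ} [Fact p.Prime] {n m l : ℕ} (r : Fin m → FreeProP p n)
    (φ : FreeProP p n →ₜ* GL (Fin l) (PadicAlgCl p)) (χ : FreeProP p n →ₜ* Gam p)
    (d : ℕ) (Δ : IwasawaTensor p) : Prop :=
  IsGCDOfIdeal Δ (fittingIdeal (foxMatrix r φ χ) d)

/-! ### Finitely presented pro-`p` groups -/

/-- `π : F_n → G` exhibits the (Hausdorff) group `G` as the pro-`p` group with generators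
`g_1, …, g_n` and relators `r_1, …, r_m`: it is surjective and its kernel is the smallest closed
normal subgroup containing the relators. -/
structure IsProPPresentation {p n m : ℕ} (r : Fin m → FreeProP p n)
    {G : Type*} [Group G] [TopologicalSpace G] (π : FreeProP p n →ₜ* G) : Prop where
  surjective : Function.Surjective π
  ker_eq : {x | π x = 1} = closure (Subgroup.normalClosure (Set.range r) : Set (FreeProP p n))

/-! ### First continuous cohomology with coefficients in a representation -/

section Cohomology

variable {K : Type*} [Field K] [TopologicalSpace K] [IsTopologicalRing K]
  {G : Type*} [Group G] [TopologicalSpace G] {l : ℕ}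

/-- Continuous 1-cocycles: continuous maps `β : G → K^l` with `β(xy) = β(x) + ρ(x) β(y)`. -/
def contCocycles (ρ : G →ₜ* GL (Fin l) K) : Submodule K (G → Fin l → K) where
  carrier := {β | Continuous β ∧
    ∀ x y, β (x * y) = β x + (ρ x : Matrix (Fin l) (Fin l) K).mulVec (β y)}
  add_mem' := fun {β β'} h h' => ⟨h.1.add h'.1, fun x y => by
    simp only [Pi.add_apply, h.2 x y, h'.2 x y, Matrix.mulVec_add]; abel⟩
  zero_mem' := ⟨continuous_const, fun x y => by simp⟩
  smul_mem' := fun c β h => ⟨h.1.const_smul c, fun x y => by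
    simp only [Pi.smul_apply, h.2 x y, Matrix.mulVec_smul, smul_add]⟩

/-- Continuous 1-coboundaries: continuous maps of the form `x ↦ ρ(x) v - v`. -/
def contCoboundaries (ρ : G →ₜ* GL (Fin l) K) : Submodule K (G → Fin l → K) where
  carrier := {β | Continuous β ∧
    ∃ v : Fin l → K, ∀ x, β x = (ρ x : Matrix (Fin l) (Fin l) K).mulVec v - v}
  add_mem' := fun {β β'} h h' => ⟨h.1.add h'.1, by
    obtain ⟨v, hv⟩ := h.2
    obtain ⟨w, hw⟩ := h'.2
    exact ⟨v + w, fun x => by simp only [Pi.add_apply, hv x, hw x, Matrix.mulVec_add]; abel⟩⟩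
  zero_mem' := ⟨continuous_const, 0, fun x => by simp⟩
  smul_mem' := fun c β h => ⟨h.1.const_smul c, by
    obtain ⟨v, hv⟩ := h.2
    exact ⟨c • v, fun x => by simp only [Pi.smul_apply, hv x, Matrix.mulVec_smul, smul_sub]⟩⟩

/-- The first continuous cohomology group `H^1(G, (K^l)_ρ) = Z^1 / B^1`. -/
abbrev ContH1 (ρ : G →ₜ* GL (Fin l) K) : Type _ :=
  contCocycles ρ ⧸ (contCoboundaries ρ).submoduleOf (contCocycles ρ)

end Cohomology

end

/-! The proof is a dimension count. By Fox calculus, a vector `v` with `n(k-1)` entries determines a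
cocycle on `F_n` for the specialised representation: its value at `x` is the sum of the specialised
matrices of `∂x/∂g_i` applied to the blocks of `v`, and its values at the generators are those
blocks. Its values at the relators are the entries of `Q|_{γ=a}` applied to `v`. Hence every `v` in
the kernel of `Q|_{γ=a}` gives a cocycle that vanishes on the relators and so descends to `G`; the
resulting map from this kernel to `Z¹` is injective. Since `Δ` divides every minor of size
`n(k-1)-(k-1)`, a zero of `Δ` kills all of them after specialisation. The rank is therefore less
than `n(k-1)-(k-1)` and the kernel has dimension greater than `k-1`, whereas `B¹`, an image of the
`(k-1)`-dimensional coefficient space, has dimension at most `k-1`. So `Z¹` is not contained in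
`B¹`. The algebra is carried by `foxCocycle_mul`, `lt_finrank_ker_of_fittingIdeal`,
`IsProPPresentation.descend_mem_contCocycles` and `nontrivial_contH1_of_injective`. Most of the work
is analytic. The Fox derivatives, the extension of the twist to `ℤ_p[[F_n]]` and the evaluation at
`a` are defined by choice with default `0`, so their existence has to be proved:
`FreeProP.exists_foxDerivative`, `exists_completeTwist`, `exists_evaluation`. The tools are density
of the discrete free group in `F_n`, density of the span of `H` in `ℤ_p[[H]]`, and integration of
continuous functions against elements of `ℤ_p[[H]]`. -/

open scoped TensorProduct

noncomputable section

/-! ### The topology of the free pro-`p` group -/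

namespace FreeProP

variable {p n : ℕ}

/-- The projection of the free pro-`p` group to one of its defining finite quotients. -/
def toQuot (N : PPowerQuotientIndex p n) : FreeProP p n →* FreeGroup (Fin n) ⧸ N.1 :=
  (Pi.evalMonoidHom _ N).comp (freeProPSubgroup p n).subtype

theorem ext_toQuot {x y : FreeProP p n} (h : ∀ N, toQuot N x = toQuot N y) : x = y :=
  Subtype.ext (funext h)

theorem map_toQuot (x : FreeProP p n) {N M : PPowerQuotientIndex p n} (h : N.1 ≤ M.1) :
    QuotientGroup.map N.1 M.1 (MonoidHom.id _) h (toQuot N x) = toQuot M x :=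
  x.2 N M h

/-- The canonical map from the discrete free group to the free pro-`p` group. -/
def ofFree (p n : ℕ) : FreeGroup (Fin n) →* FreeProP p n where
  toFun w := ⟨fun _ => QuotientGroup.mk w, fun _ _ _ => rfl⟩
  map_one' := rfl
  map_mul' _ _ := rfl

@[simp] theorem toQuot_ofFree (N : PPowerQuotientIndex p n) (w : FreeGroup (Fin n)) :
    toQuot N (ofFree p n w) = QuotientGroup.mk w := rfl

theorem ofFree_of (i : Fin n) : ofFree p n (FreeGroup.of i) = gen p i := rfl

/-- The relative index of `N` in `M` divides the index of the normal subgroup `N`, so it is again a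
power of `p`. This makes the defining inverse system of `F_n` directed downwards. -/
theorem index_inf_eq_prime_pow {G : Type*} [Group G] [hp : Fact p.Prime] {N M : Subgroup G}
    [N.Normal] (hN : ∃ e, N.index = p ^ e) (hM : ∃ e, M.index = p ^ e) :
    ∃ e, (N ⊓ M).index = p ^ e := by
  obtain ⟨a, ha⟩ := hN
  obtain ⟨b, hb⟩ := hM
  have h1 : (N ⊓ M).index = N.relIndex M * M.index := by
    rw [← Subgroup.inf_relIndex_right, Subgroup.relIndex_mul_index inf_le_right]
  have h2 : N.relIndex M ∣ p ^ a := by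
    rw [← ha]; exact Subgroup.relIndex_dvd_index_of_normal N M
  obtain ⟨c, -, hc⟩ := (Nat.dvd_prime_pow hp.out).1 h2
  exact ⟨c + b, by rw [h1, hc, hb, pow_add]⟩

instance [Fact p.Prime] : SemilatticeInf (PPowerQuotientIndex p n) :=
  Subtype.semilatticeInf fun {N M} hN hM => by
    have := hN.1
    have := hM.1
    exact ⟨inferInstance, index_inf_eq_prime_pow hN.2 hM.2⟩

instance [Fact p.Prime] : OrderTop (PPowerQuotientIndex p n) where
  top := ⟨⊤, inferInstance, 0, by simp⟩
  le_top N := le_top (a := N.1)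

instance [Fact p.Prime] : Nonempty (PPowerQuotientIndex p n) := ⟨⊤⟩

instance (N : PPowerQuotientIndex p n) : TopologicalSpace (FreeGroup (Fin n) ⧸ N.1) := ⊥
instance (N : PPowerQuotientIndex p n) : DiscreteTopology (FreeGroup (Fin n) ⧸ N.1) := ⟨rfl⟩
instance [hp : Fact p.Prime] (N : PPowerQuotientIndex p n) : Finite (FreeGroup (Fin n) ⧸ N.1) := by
  obtain ⟨e, he⟩ := N.2.2
  have : N.1.FiniteIndex := ⟨by rw [he]; exact pow_ne_zero _ hp.out.ne_zero⟩
  infer_instance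

theorem isInducing_toQuot :
    Topology.IsInducing (fun (x : FreeProP p n) (N : PPowerQuotientIndex p n) => toQuot N x) :=
  ⟨rfl⟩

theorem continuous_toQuot (N : PPowerQuotientIndex p n) :
    Continuous (toQuot (p := p) (n := n) N) :=
  (continuous_apply N).comp isInducing_toQuot.continuous

instance instIsTopologicalGroup : IsTopologicalGroup (FreeProP p n) :=
  topologicalGroup_induced (MonoidHom.pi fun N : PPowerQuotientIndex p n => toQuot N)

theorem isEmbedding_toQuot :
    Topology.IsEmbedding (fun (x : FreeProP p n) (N : PPowerQuotientIndex p n) => toQuot N x) :=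
  ⟨isInducing_toQuot, fun _ _ h => ext_toQuot (congrFun h)⟩

instance instT2Space : T2Space (FreeProP p n) := isEmbedding_toQuot.t2Space

instance instTotallyDisconnectedSpace : TotallyDisconnectedSpace (FreeProP p n) :=
  isEmbedding_toQuot.isTotallyDisconnected_range.1
    (isTotallyDisconnected_of_totallyDisconnectedSpace _)

/-- The compatibility conditions are equalities of continuous maps to discrete spaces, hence closed.
Compactness of `F_n` then follows from Tychonoff. -/
theorem isClosedEmbedding_toQuot :
    Topology.IsClosedEmbedding
      (fun (x : FreeProP p n) (N : PPowerQuotientIndex p n) => toQuot N x) := by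
  refine ⟨isEmbedding_toQuot, ?_⟩
  have h : Set.range (fun (x : FreeProP p n) (N : PPowerQuotientIndex p n) => toQuot N x) =
      ⋂ (N : PPowerQuotientIndex p n) (M : PPowerQuotientIndex p n) (h : N.1 ≤ M.1),
        {x | QuotientGroup.map N.1 M.1 (MonoidHom.id _) h (x N) = x M} := by
    ext x
    simp only [Set.mem_range, Set.mem_iInter]
    exact ⟨fun ⟨y, hy⟩ => hy ▸ y.2, fun hx => ⟨⟨x, hx⟩, rfl⟩⟩
  rw [h]
  refine isClosed_iInter fun N => isClosed_iInter fun M => isClosed_iInter fun h => ?_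
  exact isClosed_eq (continuous_of_discreteTopology.comp (continuous_apply N)) (continuous_apply M)

instance instCompactSpace [Fact p.Prime] : CompactSpace (FreeProP p n) :=
  isClosedEmbedding_toQuot.compactSpace

/-- A basic neighbourhood of `1` constrains only finitely many quotients, and the intersection of
the corresponding subgroups is again an index. -/
theorem exists_ker_toQuot_subset [Fact p.Prime] {W : Set (FreeProP p n)} (hW : W ∈ nhds 1) :
    ∃ N : PPowerQuotientIndex p n, ∀ x, toQuot N x = 1 → x ∈ W := by
  rw [isInducing_toQuot.nhds_eq_comap, Filter.mem_comap] at hW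
  obtain ⟨t, ht, htW⟩ := hW
  rw [nhds_pi, Filter.mem_pi] at ht
  obtain ⟨I, hI, s, hs, hst⟩ := ht
  refine ⟨hI.toFinset.inf id, fun x hx => htW (hst fun N hN => ?_)⟩
  have hle : (hI.toFinset.inf id : PPowerQuotientIndex p n) ≤ N :=
    Finset.inf_le (f := id) (hI.mem_toFinset.2 hN)
  have : toQuot N x = 1 := by rw [← map_toQuot x hle, hx, map_one]
  change toQuot N x ∈ s N
  rw [this]
  exact mem_of_mem_nhds (by simpa using hs N)

theorem denseRange_ofFree [Fact p.Prime] : DenseRange (ofFree p n) := by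
  intro x
  rw [mem_closure_iff_nhds]
  intro t ht
  have : (fun y => x * y) ⁻¹' t ∈ nhds (1 : FreeProP p n) :=
    (continuous_const_mul x).continuousAt.preimage_mem_nhds (by simpa using ht)
  obtain ⟨N, hN⟩ := exists_ker_toQuot_subset this
  obtain ⟨w, hw⟩ := QuotientGroup.mk_surjective (toQuot N x)
  have := hN (x⁻¹ * ofFree p n w) (by rw [map_mul, map_inv, toQuot_ofFree, hw, inv_mul_cancel])
  exact ⟨ofFree p n w, by simpa using this, w, rfl⟩

/-- Every finite quotient of the free pro-`p` group is a `p`-group. -/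
theorem exists_card_quotient_eq_pow [hp : Fact p.Prime] (U : OpenNormalSubgroup (FreeProP p n)) :
    ∃ e, Nat.card (FreeProP p n ⧸ U.toSubgroup) = p ^ e := by
  obtain ⟨N, hN⟩ := exists_ker_toQuot_subset (U.isOpen'.mem_nhds (one_mem U))
  obtain ⟨a, ha⟩ := N.2.2
  have hle : (toQuot N).ker ≤ U.toSubgroup := fun x hx => hN x hx
  have h1 : (toQuot (p := p) (n := n) N).ker.index ∣ p ^ a := by
    rw [Subgroup.index_ker, ← ha]
    exact Subgroup.card_subgroup_dvd_card _
  obtain ⟨c, -, hc⟩ := (Nat.dvd_prime_pow hp.out).1 ((Subgroup.index_dvd_of_le hle).trans h1)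
  exact ⟨c, hc⟩

end FreeProP

/-! ### Topology and integration on complete group algebras -/

namespace CompleteGroupAlgebra

open Filter Topology

variable {p : ℕ} [Fact p.Prime] {H : Type*} [Group H] [TopologicalSpace H]

/-- The coordinate functionals on the complete group algebra. -/
def coord (U : OpenNormalSubgroup H) (c : H ⧸ U.toSubgroup) :
    CompleteGroupAlgebra p H →ₗ[ℤ_[p]] ℤ_[p] :=
  Finsupp.lapply c ∘ₗ (MonoidAlgebra.coeffLinearEquiv ℤ_[p]).toLinearMap ∘ₗ
    (proj p U).toLinearMap

theorem coord_apply (U : OpenNormalSubgroup H) (c : H ⧸ U.toSubgroup)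
    (z : CompleteGroupAlgebra p H) : coord U c z = (proj p U z).coeff c := rfl

theorem ext_coord {x y : CompleteGroupAlgebra p H} (h : ∀ U c, coord U c x = coord U c y) :
    x = y :=
  ext_proj fun U => MonoidAlgebra.ext (Finsupp.ext (h U))

theorem isInducing_coord : IsInducing (fun (x : CompleteGroupAlgebra p H)
    (U : OpenNormalSubgroup H) (c : H ⧸ U.toSubgroup) => coord U c x) := ⟨rfl⟩

theorem continuous_coord (U : OpenNormalSubgroup H) (c : H ⧸ U.toSubgroup) :
    Continuous (coord (p := p) U c) :=
  (continuous_apply c).comp ((continuous_apply U).comp isInducing_coord.continuous)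

theorem continuous_iff_coord {X : Type*} [TopologicalSpace X] {f : X → CompleteGroupAlgebra p H} :
    Continuous f ↔ ∀ U c, Continuous fun x => coord U c (f x) := by
  rw [isInducing_coord.continuous_iff, continuous_pi_iff]
  simp only [continuous_pi_iff]
  rfl

theorem tendsto_iff_coord {X : Type*} {l : Filter X} {f : X → CompleteGroupAlgebra p H}
    {z : CompleteGroupAlgebra p H} :
    Tendsto f l (𝓝 z) ↔ ∀ U c, Tendsto (fun x => coord U c (f x)) l (𝓝 (coord U c z)) := by
  rw [isInducing_coord.tendsto_nhds_iff, tendsto_pi_nhds]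
  simp only [tendsto_pi_nhds]
  rfl

instance instT2Space : T2Space (CompleteGroupAlgebra p H) :=
  T2Space.of_injective_continuous (f := fun (x : CompleteGroupAlgebra p H)
    (U : OpenNormalSubgroup H) (c : H ⧸ U.toSubgroup) => coord U c x)
    (fun _ _ h => ext_coord fun U c => congrFun (congrFun h U) c) isInducing_coord.continuous

theorem proj_of (U : OpenNormalSubgroup H) (x : H) :
    proj p U (of p x) = MonoidAlgebra.single (QuotientGroup.mk x) 1 := rfl

theorem mapDomain_proj {U V : OpenNormalSubgroup H} (h : U.toSubgroup ≤ V.toSubgroup)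
    (z : CompleteGroupAlgebra p H) :
    (proj p U z).mapDomain (openQuotientMap h) = proj p V z := z.2 U V h

variable {M : Type*} [AddCommGroup M] [Module ℤ_[p] M]

/-- The functional on `ℤ_p[[H]]` given by a function on a finite quotient of `H`. -/
def levelSum (U : OpenNormalSubgroup H) (g : H ⧸ U.toSubgroup → M) :
    CompleteGroupAlgebra p H →ₗ[ℤ_[p]] M :=
  Finsupp.linearCombination ℤ_[p] g ∘ₗ (MonoidAlgebra.coeffLinearEquiv ℤ_[p]).toLinearMap ∘ₗ
    (proj p U).toLinearMap

theorem levelSum_apply (U : OpenNormalSubgroup H) (g : H ⧸ U.toSubgroup → M)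
    (z : CompleteGroupAlgebra p H) :
    levelSum U g z = Finsupp.linearCombination ℤ_[p] g (proj p U z).coeff := rfl

theorem levelSum_of (U : OpenNormalSubgroup H) (g : H ⧸ U.toSubgroup → M) (x : H) :
    levelSum U g (of p x) = g (QuotientGroup.mk x) := by
  rw [levelSum_apply, proj_of, MonoidAlgebra.coeff_single, Finsupp.linearCombination_single,
    one_smul]

theorem levelSum_of_le {U V : OpenNormalSubgroup H} (h : U.toSubgroup ≤ V.toSubgroup)
    (g : H ⧸ V.toSubgroup → M) (z : CompleteGroupAlgebra p H) :
    levelSum V g z = levelSum U (g ∘ openQuotientMap h) z := by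
  rw [levelSum_apply, ← mapDomain_proj h]
  exact Finsupp.linearCombination_mapDomain _ _ _

theorem levelSum_eq_sum (U : OpenNormalSubgroup H) [Fintype (H ⧸ U.toSubgroup)]
    (g : H ⧸ U.toSubgroup → M) (z : CompleteGroupAlgebra p H) :
    levelSum U g z = ∑ q, coord U q z • g q := by
  rw [levelSum_apply, Finsupp.linearCombination_apply, Finsupp.sum_fintype _ _ (by simp)]
  rfl

theorem linearMap_proj_eq_levelSum (U : OpenNormalSubgroup H)
    (T : MonoidAlgebra ℤ_[p] (H ⧸ U.toSubgroup) →ₗ[ℤ_[p]] M) (z : CompleteGroupAlgebra p H) :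
    T (proj p U z) = levelSum U (fun q => T (MonoidAlgebra.single q 1)) z := by
  have : T = Finsupp.linearCombination ℤ_[p] (fun q => T (MonoidAlgebra.single q 1)) ∘ₗ
      (MonoidAlgebra.coeffLinearEquiv ℤ_[p]).toLinearMap := by
    refine MonoidAlgebra.lhom_ext' fun q => LinearMap.ext_ring ?_
    change T (MonoidAlgebra.single q 1) =
      Finsupp.linearCombination ℤ_[p] _ (MonoidAlgebra.single q (1 : ℤ_[p])).coeff
    rw [MonoidAlgebra.coeff_single, Finsupp.linearCombination_single, one_smul]
  exact LinearMap.congr_fun this _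

instance : Nonempty (OpenNormalSubgroup H) :=
  ⟨{ toSubgroup := ⊤, isOpen' := isOpen_univ }⟩

/-! ### Density of the group elements, and integration over profinite groups -/

section Compact

variable [IsTopologicalGroup H] [CompactSpace H]

instance (U : OpenNormalSubgroup H) : Finite (H ⧸ U.toSubgroup) :=
  Subgroup.quotient_finite_of_isOpen U.toSubgroup U.isOpen'

theorem continuous_levelSum [TopologicalSpace M] [ContinuousAdd M] [ContinuousSMul ℤ_[p] M]
    (U : OpenNormalSubgroup H) (g : H ⧸ U.toSubgroup → M) :
    Continuous (levelSum (p := p) U g) := by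
  have := Fintype.ofFinite (H ⧸ U.toSubgroup)
  rw [show (levelSum (p := p) U g : _ → M) = _ from funext (levelSum_eq_sum U g)]
  exact continuous_finsetSum _ fun q _ => (continuous_coord U q).smul continuous_const

theorem continuous_linearMap_proj [TopologicalSpace M] [ContinuousAdd M] [ContinuousSMul ℤ_[p] M]
    (U : OpenNormalSubgroup H) (T : MonoidAlgebra ℤ_[p] (H ⧸ U.toSubgroup) →ₗ[ℤ_[p]] M) :
    Continuous fun z : CompleteGroupAlgebra p H => T (proj p U z) := by
  simp only [linearMap_proj_eq_levelSum]
  exact continuous_levelSum U _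

theorem continuous_const_mul (z : CompleteGroupAlgebra p H) : Continuous fun w => z * w :=
  continuous_iff_coord.2 fun U c => by
    simp only [coord_apply, map_mul]
    exact continuous_linearMap_proj U (Finsupp.lapply c ∘ₗ
      (MonoidAlgebra.coeffLinearEquiv ℤ_[p]).toLinearMap ∘ₗ LinearMap.mulLeft ℤ_[p] (proj p U z))

theorem continuous_mul_const (w : CompleteGroupAlgebra p H) : Continuous fun z => z * w :=
  continuous_iff_coord.2 fun U c => by
    simp only [coord_apply, map_mul]
    exact continuous_linearMap_proj U (Finsupp.lapply c ∘ₗ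
      (MonoidAlgebra.coeffLinearEquiv ℤ_[p]).toLinearMap ∘ₗ LinearMap.mulRight ℤ_[p] (proj p U w))

/-- Replacing each coset of `U` by a representative does not change the projection to any level `V`
above `U`, so every coordinate is eventually constant. -/
theorem tendsto_levelSum_out (z : CompleteGroupAlgebra p H) :
    Tendsto (fun U : OpenNormalSubgroup H => levelSum U (fun q => of p q.out) z) atBot (𝓝 z) := by
  refine tendsto_iff_coord.2 fun V c => tendsto_const_nhds.congr' ?_
  filter_upwards [eventually_le_atBot V] with U hU
  have hUV : U.toSubgroup ≤ V.toSubgroup := hU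
  have := Fintype.ofFinite (H ⧸ U.toSubgroup)
  have key : proj p V (levelSum U (fun q => of p q.out) z) = proj p V z := by
    rw [← mapDomain_proj hUV, levelSum_eq_sum, map_sum, ← mapDomain_proj hUV z]
    simp only [map_smul, proj_of]
    congr 1
    refine MonoidAlgebra.ext (Finsupp.ext fun q => ?_)
    simp [coord_apply]
  rw [coord_apply, coord_apply, key]

/-- The group elements span a dense submodule of the complete group algebra. -/
theorem linearMap_ext_of [TopologicalSpace M] [T2Space M] {L L' : CompleteGroupAlgebra p H →ₗ[ℤ_[p]] M}
    (hL : Continuous L) (hL' : Continuous L') (h : ∀ x, L (of p x) = L' (of p x)) : L = L' := by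
  ext z
  refine tendsto_nhds_unique ((hL.tendsto z).comp (tendsto_levelSum_out z)) ?_
  refine ((hL'.tendsto z).comp (tendsto_levelSum_out z)).congr fun U => ?_
  have := Fintype.ofFinite (H ⧸ U.toSubgroup)
  simp only [Function.comp_apply, levelSum_eq_sum, map_sum, map_smul, h]

/-- By the ultrametric inequality and integrality of the coefficients, the bound does not depend on
the number of cosets or on `z`. This gives the uniform convergence of the Riemann sums in
`exists_integral`. -/
theorem norm_levelSum_le (U : OpenNormalSubgroup H) (g : H ⧸ U.toSubgroup → ℤ_[p]) {ε : ℝ}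
    (hε : 0 ≤ ε) (hg : ∀ q, ‖g q‖ ≤ ε) (z : CompleteGroupAlgebra p H) : ‖levelSum U g z‖ ≤ ε := by
  have := Fintype.ofFinite (H ⧸ U.toSubgroup)
  rw [levelSum_eq_sum]
  refine IsUltrametricDist.norm_sum_le_of_forall_le_of_nonneg hε fun q _ => ?_
  rw [smul_eq_mul, norm_mul]
  exact (mul_le_of_le_one_left (norm_nonneg _) (PadicInt.norm_le_one _)).trans (hg q)

variable [TotallyDisconnectedSpace H]

/-- Uniform continuity by compactness: finitely many cosets `c · U c` cover `H`, and for `V` below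
all these `U c`, two points in one coset of `V` lie in a common `c · U c` and can both be compared
with `c`. -/
theorem exists_openNormalSubgroup_oscillation_le {E : Type*} [NormedAddCommGroup E] {f : H → E}
    (hf : Continuous f) {ε : ℝ} (hε : 0 < ε) :
    ∃ U : OpenNormalSubgroup H, ∀ x y, x⁻¹ * y ∈ U.toSubgroup → ‖f y - f x‖ ≤ ε := by
  have h1 : ∀ x : H, ∃ U : OpenNormalSubgroup H, ∀ y, x⁻¹ * y ∈ U.toSubgroup →
      ‖f y - f x‖ < ε / 2 := fun x => by
    obtain ⟨U, hU⟩ := ProfiniteGrp.exist_openNormalSubgroup_sub_open_nhds_of_one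
      (U := {u | ‖f (x * u) - f x‖ < ε / 2})
      (isOpen_lt ((hf.comp (_root_.continuous_const_mul x)).sub continuous_const).norm
        continuous_const) (by simpa using hε)
    exact ⟨U, fun y hy => by simpa using hU hy⟩
  choose U hU using h1
  obtain ⟨t, ht⟩ := CompactSpace.elim_nhds_subcover (fun x => {y | x⁻¹ * y ∈ (U x).toSubgroup})
    fun x => ((U x).isOpen'.preimage (_root_.continuous_const_mul x⁻¹)).mem_nhds
      (by simp [one_mem])
  obtain ⟨V, hV⟩ : ∃ V : OpenNormalSubgroup H, ∀ x ∈ t, V ≤ U x :=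
    ⟨t.inf' (by
      rw [← Finset.coe_nonempty]
      by_contra hne
      rw [Set.not_nonempty_iff_eq_empty, Finset.coe_eq_empty] at hne
      have : (1 : H) ∈ (⊤ : Set H) := trivial
      rw [← ht, hne] at this
      simp at this) U, fun x hx => Finset.inf'_le _ hx⟩
  refine ⟨V, fun x y hxy => ?_⟩
  have : x ∈ ⋃ x ∈ t, {y | x⁻¹ * y ∈ (U x).toSubgroup} := ht ▸ trivial
  simp only [Set.mem_iUnion] at this
  obtain ⟨c, hc, hxc⟩ := this
  have hyc : c⁻¹ * y ∈ (U c).toSubgroup := by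
    have := mul_mem hxc (hV c hc hxy)
    rwa [show c⁻¹ * x * (x⁻¹ * y) = c⁻¹ * y by group] at this
  calc ‖f y - f x‖ = ‖(f y - f c) - (f x - f c)‖ := by rw [sub_sub_sub_cancel_right]
    _ ≤ ‖f y - f c‖ + ‖f x - f c‖ := norm_sub_le _ _
    _ ≤ ε := by linarith [hU c y hyc, hU c x hxc]

/-- Integration of a continuous function on a profinite group against the measures in
`ℤ_p[[H]]`. -/
theorem exists_integral {f : H → ℤ_[p]} (hf : Continuous f) :
    ∃ L : CompleteGroupAlgebra p H →ₗ[ℤ_[p]] ℤ_[p], Continuous L ∧ ∀ x, L (of p x) = f x := by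
  let S (U : OpenNormalSubgroup H) : CompleteGroupAlgebra p H →ₗ[ℤ_[p]] ℤ_[p] :=
    levelSum U fun q => f q.out
  -- Since `ℤ_p` is compact, the Riemann sums converge along any ultrafilter finer than `atBot`, and
  -- linearity passes to the limit.
  let F : Ultrafilter (OpenNormalSubgroup H) := Ultrafilter.of atBot
  have hF : (F : Filter (OpenNormalSubgroup H)) ≤ atBot := Ultrafilter.of_le atBot
  let I (z : CompleteGroupAlgebra p H) : ℤ_[p] := (F.map fun U => S U z).lim
  have hI (z) : Tendsto (fun U => S U z) F (𝓝 (I z)) := Ultrafilter.le_nhds_lim _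
  let L : CompleteGroupAlgebra p H →ₗ[ℤ_[p]] ℤ_[p] :=
    { toFun := I
      map_add' := fun z w => tendsto_nhds_unique (hI (z + w))
        (((hI z).add (hI w)).congr fun U => (map_add _ _ _).symm)
      map_smul' := fun c z => tendsto_nhds_unique (hI (c • z))
        (((hI z).const_smul c).congr fun U => (map_smul _ _ _).symm) }
  have hosc : ∀ ε > 0, ∃ V, ∀ U ≤ V, ∀ z, ‖S U z - S V z‖ ≤ ε := fun ε hε => by
    obtain ⟨V, hV⟩ := exists_openNormalSubgroup_oscillation_le hf hε
    refine ⟨V, fun U hU z => ?_⟩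
    have hUV : U.toSubgroup ≤ V.toSubgroup := hU
    -- Written at the finer level `U`, the difference is the sum of the differences of `f` at two
    -- representatives of the same coset of `V`.
    have : S U z - S V z = levelSum U ((fun q => f q.out) -
        (fun q : H ⧸ V.toSubgroup => f q.out) ∘ openQuotientMap hUV) z := by
      simp only [S, levelSum_of_le hUV, levelSum_apply]
      rw [Finsupp.linearCombination_apply, Finsupp.linearCombination_apply,
        Finsupp.linearCombination_apply, ← Finsupp.sum_sub]
      exact Finsupp.sum_congr fun q _ => (smul_sub _ _ _).symm
    rw [this]
    refine norm_levelSum_le U _ hε.le (fun q => hV _ _ ?_) z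
    rw [← QuotientGroup.eq, QuotientGroup.out_eq']
    conv_lhs => rw [← QuotientGroup.out_eq' q]
    rfl
  have hlim : ∀ ε > 0, ∃ V, ∀ z, ‖I z - S V z‖ ≤ ε := fun ε hε => by
    obtain ⟨V, hV⟩ := hosc ε hε
    exact ⟨V, fun z => le_of_tendsto ((hI z).sub_const _).norm
      (((eventually_le_atBot V).mono fun U hU => hV U hU z).filter_mono hF)⟩
  refine ⟨L, continuous_of_uniform_approx_of_continuous fun u hu => ?_, fun x => ?_⟩
  · obtain ⟨ε, hε, hu⟩ := Metric.mem_uniformity_dist.1 hu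
    obtain ⟨V, hV⟩ := hlim (ε / 2) (half_pos hε)
    exact ⟨S V, continuous_levelSum V _, fun z => hu (by
      rw [dist_eq_norm]; exact (hV z).trans_lt (half_lt_self hε))⟩
  · refine tendsto_nhds_unique (hI (of p x)) (Metric.tendsto_nhds.2 fun ε hε => Filter.Eventually.filter_mono hF ?_)
    obtain ⟨V, hV⟩ := exists_openNormalSubgroup_oscillation_le hf (half_pos hε)
    filter_upwards [eventually_le_atBot V] with U hU
    rw [dist_eq_norm]
    simp only [S, levelSum_of]
    refine (hV _ _ (hU ?_)).trans_lt (half_lt_self hε)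
    change _ ∈ U.toSubgroup
    rw [← QuotientGroup.eq, QuotientGroup.out_eq']

end Compact

end CompleteGroupAlgebra

/-! ### Existence of the pro-`p` Fox derivatives -/

section DiscreteFox

variable {ι R Q : Type*} [Ring R] [Group Q]

/-- The action of a group on a ring by left multiplication with units. -/
def leftMulAut (τ : Q →* R) : Q →* MulAut (Multiplicative R) where
  toFun q :=
    { toFun := fun x => .ofAdd (τ q * x.toAdd)
      invFun := fun x => .ofAdd (τ q⁻¹ * x.toAdd)
      left_inv := fun x => by
        simp only [toAdd_ofAdd, ← mul_assoc, ← map_mul, inv_mul_cancel, map_one, one_mul,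
          ofAdd_toAdd]
      right_inv := fun x => by
        simp only [toAdd_ofAdd, ← mul_assoc, ← map_mul, mul_inv_cancel, map_one, one_mul,
          ofAdd_toAdd]
      map_mul' := fun x y => by rw [toAdd_mul, mul_add, ofAdd_add] }
  map_one' := by ext x; simp
  map_mul' a b := by ext x; simp [mul_assoc]

/-- The product rule forces the value at `1` and at inverses, so the values on the generators
determine everything. This gives the compatibility of the Fox derivatives with change of
coefficients and of quotient. -/
theorem crossedHom_ext (t : FreeGroup ι →* R) {d d' : FreeGroup ι → R}
    (hd : ∀ x y, d (x * y) = d x + t x * d y) (hd' : ∀ x y, d' (x * y) = d' x + t x * d' y)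
    (h : ∀ j, d (FreeGroup.of j) = d' (FreeGroup.of j)) (w : FreeGroup ι) : d w = d' w := by
  have key : ∀ {d : FreeGroup ι → R}, (∀ x y, d (x * y) = d x + t x * d y) →
      d 1 = 0 ∧ ∀ x, d x⁻¹ = -(t x⁻¹ * d x) := fun {d} hd => by
    have h1 : d 1 = 0 := by simpa using hd 1 1
    refine ⟨h1, fun x => ?_⟩
    rw [eq_neg_iff_add_eq_zero, ← hd, inv_mul_cancel, h1]
  induction w using FreeGroup.induction_on with
  | C1 => rw [(key hd).1, (key hd').1]
  | of j => exact h j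
  | inv_of j hj => rw [(key hd).2, (key hd').2, hj]
  | mul x y hx hy => rw [hd, hd', hx, hy]

/-- The homomorphism `w ↦ (∂w/∂x_i, w)` to a semidirect product. -/
def foxAffine [DecidableEq ι] (σ : FreeGroup ι →* Q) (τ : Q →* R) (i : ι) :
    FreeGroup ι →* Multiplicative R ⋊[leftMulAut τ] Q :=
  FreeGroup.lift fun j => ⟨.ofAdd (if j = i then 1 else 0), σ (FreeGroup.of j)⟩

/-- The Fox derivative on the discrete free group, with values in a ring. -/
def discreteFox [DecidableEq ι] (σ : FreeGroup ι →* Q) (τ : Q →* R) (i : ι) (w : FreeGroup ι) : R :=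
  (foxAffine σ τ i w).left.toAdd

variable [DecidableEq ι] (σ : FreeGroup ι →* Q) (τ : Q →* R) (i : ι)

theorem foxAffine_right (w : FreeGroup ι) : (foxAffine σ τ i w).right = σ w := by
  have : SemidirectProduct.rightHom.comp (foxAffine σ τ i) = σ :=
    FreeGroup.ext_hom _ _ fun j => by simp [foxAffine]
  exact DFunLike.congr_fun this w

theorem discreteFox_of (j : ι) :
    discreteFox σ τ i (FreeGroup.of j) = if j = i then 1 else 0 := by
  simp [discreteFox, foxAffine]

/-- The left component of a product in the semidirect product is exactly the Fox product rule. -/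
theorem discreteFox_mul (x y : FreeGroup ι) :
    discreteFox σ τ i (x * y) = discreteFox σ τ i x + τ (σ x) * discreteFox σ τ i y := by
  rw [discreteFox, map_mul, SemidirectProduct.mul_left, foxAffine_right]
  rfl

theorem map_discreteFox {R' : Type*} [Ring R'] (s : R →+* R') (w : FreeGroup ι) :
    s (discreteFox σ τ i w) = discreteFox σ ((s : R →* R').comp τ) i w := by
  refine crossedHom_ext (d := fun w => s (discreteFox σ τ i w)) (((s : R →* R').comp τ).comp σ)
    (fun x y => ?_) (discreteFox_mul _ _ i) (fun j => ?_) w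
  · rw [discreteFox_mul, map_add, map_mul]; rfl
  · simp only [discreteFox_of]; split_ifs <;> simp

theorem discreteFox_comp {Q' : Type*} [Group Q'] (f : Q →* Q') (τ : Q' →* R) (w : FreeGroup ι) :
    discreteFox (f.comp σ) τ i w = discreteFox σ (τ.comp f) i w := by
  refine crossedHom_ext ((τ.comp f).comp σ) (discreteFox_mul (f.comp σ) τ i)
    (discreteFox_mul _ _ i) (fun j => ?_) w
  simp only [discreteFox_of]

/-- The semidirect product of two groups of `p`-power order has `p`-power order, and the index of
the kernel is the order of a subgroup of it. Such a kernel is thus one of the subgroups defining the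
topology of `F_n`. -/
theorem exists_index_ker_foxAffine_eq_pow {p : ℕ} [hp : Fact p.Prime]
    (hR : ∃ a, Nat.card R = p ^ a) (hQ : ∃ a, Nat.card Q = p ^ a) :
    ∃ a, (foxAffine σ τ i).ker.index = p ^ a := by
  obtain ⟨a, ha⟩ := hR
  obtain ⟨b, hb⟩ := hQ
  have h : (foxAffine σ τ i).ker.index ∣ p ^ (a + b) := by
    rw [Subgroup.index_ker, pow_add, ← ha, ← hb, Nat.card_congr (Multiplicative.ofAdd (α := R)),
      ← SemidirectProduct.card (φ := leftMulAut τ)]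
    exact Subgroup.card_subgroup_dvd_card _
  obtain ⟨c, -, hc⟩ := (Nat.dvd_prime_pow hp.out).1 h
  exact ⟨c, hc⟩

end DiscreteFox

/-! ### Extension of the Fox derivatives by continuity from the free group -/

namespace FreeProP

open Filter Topology

variable {p n : ℕ} [Fact p.Prime]

/-- The hypothesis is uniform continuity for the pro-`p` topology. The extension is the limit, along
an ultrafilter, of the values at coset representatives, and the approximation is uniform in `x`. -/
theorem exists_continuous_extension (u : FreeGroup (Fin n) → ℤ_[p])
    (hu : ∀ ε > 0, ∃ N : PPowerQuotientIndex p n, ∀ w, ∀ v ∈ N.1, ‖u (w * v) - u w‖ ≤ ε) :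
    ∃ f : FreeProP p n → ℤ_[p], Continuous f ∧ ∀ w, f (ofFree p n w) = u w := by
  let S (N : PPowerQuotientIndex p n) (x : FreeProP p n) : ℤ_[p] := u (toQuot N x).out
  let F : Ultrafilter (PPowerQuotientIndex p n) := Ultrafilter.of atBot
  have hF : (F : Filter (PPowerQuotientIndex p n)) ≤ atBot := Ultrafilter.of_le atBot
  let f (x : FreeProP p n) : ℤ_[p] := (F.map fun N => S N x).lim
  have hf (x) : Tendsto (fun N => S N x) F (𝓝 (f x)) := Ultrafilter.le_nhds_lim _
  have hlim : ∀ ε > 0, ∃ N, ∀ x, ‖f x - S N x‖ ≤ ε := fun ε hε => by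
    obtain ⟨N, hN⟩ := hu ε hε
    refine ⟨N, fun x => le_of_tendsto ((hf x).sub_const _).norm
      (((eventually_le_atBot N).mono fun M hM => ?_).filter_mono hF)⟩
    have hMN : M.1 ≤ N.1 := hM
    have hmem : ((toQuot N x).out)⁻¹ * (toQuot M x).out ∈ N.1 := by
      rw [← QuotientGroup.eq, QuotientGroup.out_eq', ← map_toQuot x hMN]
      conv_lhs => rw [← QuotientGroup.out_eq' (toQuot M x)]
      rfl
    simpa [S] using hN (toQuot N x).out _ hmem
  refine ⟨f, continuous_of_uniform_approx_of_continuous fun V hV => ?_, fun w => ?_⟩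
  · obtain ⟨ε, hε, hV⟩ := Metric.mem_uniformity_dist.1 hV
    obtain ⟨N, hN⟩ := hlim (ε / 2) (half_pos hε)
    exact ⟨S N, (continuous_of_discreteTopology (f := fun q : FreeGroup (Fin n) ⧸ N.1 => u q.out)).comp
      (continuous_toQuot N), fun z => hV (by
      rw [dist_eq_norm]; exact (hN z).trans_lt (half_lt_self hε))⟩
  · refine tendsto_nhds_unique (hf _) (Metric.tendsto_nhds.2 fun ε hε =>
      Filter.Eventually.filter_mono hF ?_)
    obtain ⟨N, hN⟩ := hu (ε / 2) (half_pos hε)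
    filter_upwards [eventually_le_atBot N] with M hM
    rw [dist_eq_norm]
    have hMN : M.1 ≤ N.1 := hM
    have hmem : w⁻¹ * (toQuot M (ofFree p n w)).out ∈ N.1 := hMN (by
      rw [← QuotientGroup.eq, QuotientGroup.out_eq', toQuot_ofFree])
    have := hN w _ hmem
    rw [mul_inv_cancel_left] at this
    exact this.trans_lt (half_lt_self hε)

/-- The projection of the discrete free group to a finite quotient of the free pro-`p` group. -/
def freeToQuotient (U : OpenNormalSubgroup (FreeProP p n)) :
    FreeGroup (Fin n) →* FreeProP p n ⧸ U.toSubgroup :=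
  (QuotientGroup.mk' U.toSubgroup).comp (ofFree p n)

/-- The Fox derivative on the discrete free group with values in `ℤ_p[F_n/U]`. -/
def levelFox (U : OpenNormalSubgroup (FreeProP p n)) (i : Fin n) :
    FreeGroup (Fin n) → MonoidAlgebra ℤ_[p] (FreeProP p n ⧸ U.toSubgroup) :=
  discreteFox (freeToQuotient U) (MonoidAlgebra.of ℤ_[p] _) i

/-- Modulo `p ^ e` the derivative takes values in a finite ring of `p`-power order, so it factors
through a finite `p`-quotient of the free group. -/
theorem exists_continuous_levelFox (U : OpenNormalSubgroup (FreeProP p n)) (i : Fin n)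
    (q : FreeProP p n ⧸ U.toSubgroup) :
    ∃ f : FreeProP p n → ℤ_[p], Continuous f ∧ ∀ w, f (ofFree p n w) = (levelFox U i w).coeff q := by
  refine exists_continuous_extension _ fun ε hε => ?_
  obtain ⟨e, he⟩ := PadicInt.exists_pow_neg_lt p hε
  let s := MonoidAlgebra.mapRingHom (FreeProP p n ⧸ U.toSubgroup)
    (PadicInt.toZModPow e : ℤ_[p] →+* ZMod (p ^ e))
  let τ : (FreeProP p n ⧸ U.toSubgroup) →* MonoidAlgebra (ZMod (p ^ e)) (FreeProP p n ⧸ U.toSubgroup) :=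
    (s : _ →* _).comp (MonoidAlgebra.of ℤ_[p] _)
  have hR : ∃ a, Nat.card (MonoidAlgebra (ZMod (p ^ e)) (FreeProP p n ⧸ U.toSubgroup)) = p ^ a := by
    rw [Nat.card_congr (MonoidAlgebra.coeffEquiv.trans Finsupp.equivFunOnFinite), Nat.card_fun,
      Nat.card_zmod]
    exact ⟨_, (pow_mul _ _ _).symm⟩
  -- For `v` in this kernel the derivative of `v` vanishes modulo `p ^ e`, so by the product rule `w
  -- * v` and `w` have congruent derivatives.
  refine ⟨⟨(foxAffine (freeToQuotient U) τ i).ker, inferInstance,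
    exists_index_ker_foxAffine_eq_pow _ _ _ hR (exists_card_quotient_eq_pow U)⟩,
    fun w v hv => le_trans ?_ he.le⟩
  have hs : s (levelFox U i v) = 0 := by
    rw [levelFox, map_discreteFox, discreteFox, MonoidHom.mem_ker.1 hv]
    rfl
  rw [PadicInt.norm_le_pow_iff_mem_span_pow, ← PadicInt.ker_toZModPow, RingHom.mem_ker, levelFox,
    discreteFox_mul, MonoidAlgebra.coeff_add, Finsupp.add_apply, add_sub_cancel_left,
    ← MonoidAlgebra.coeff_mapRingHom, map_mul]
  change (_ * s (levelFox U i v)).coeff q = 0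
  rw [hs, mul_zero]
  rfl

theorem exists_foxDerivative (i : Fin n) :
    ∃ D : FreeProP p n → CompleteGroupAlgebra p (FreeProP p n), Continuous D ∧
      (∀ j, D (gen p j) = if j = i then 1 else 0) ∧
      ∀ x y, D (x * y) = D x + CompleteGroupAlgebra.of p x * D y := by
  choose f hf hfu using fun U => exists_continuous_levelFox (p := p) (n := n) U i
  let D (x : FreeProP p n) (U : OpenNormalSubgroup (FreeProP p n)) :
      MonoidAlgebra ℤ_[p] (FreeProP p n ⧸ U.toSubgroup) :=
    .ofCoeff (Finsupp.equivFunOnFinite.symm fun q => f U q x)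
  have hD (w U) : D (ofFree p n w) U = levelFox U i w :=
    MonoidAlgebra.ext (Finsupp.ext fun q => hfu U q w)
  have hcont {U : OpenNormalSubgroup (FreeProP p n)} {M : Type} [AddCommGroup M] [Module ℤ_[p] M]
      [TopologicalSpace M] [ContinuousAdd M] [ContinuousSMul ℤ_[p] M]
      (T : MonoidAlgebra ℤ_[p] (FreeProP p n ⧸ U.toSubgroup) →ₗ[ℤ_[p]] M) :
      Continuous fun x => T (D x U) := by
    have := Fintype.ofFinite (FreeProP p n ⧸ U.toSubgroup)
    have h : ∀ x, T (D x U) = ∑ q, f U q x • T (.single q 1) := fun x => by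
      have : D x U = ∑ q, f U q x • .single q 1 := by
        refine MonoidAlgebra.ext (Finsupp.ext fun q => ?_)
        classical simp [D, Finsupp.single_apply]
      rw [this, map_sum]
      exact Finset.sum_congr rfl fun q _ => map_smul T _ _
    simp only [h]
    exact continuous_finsetSum _ fun q _ => (hf U q).smul continuous_const
  let coeffAt {Q : Type} (q : Q) : MonoidAlgebra ℤ_[p] Q →ₗ[ℤ_[p]] ℤ_[p] :=
    Finsupp.lapply q ∘ₗ (MonoidAlgebra.coeffLinearEquiv ℤ_[p]).toLinearMap
  -- Compatibility of the levels is an equality of continuous functions; on the dense free group it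
  -- is the functoriality of the discrete Fox derivative.
  have hmem (x) : D x ∈ completeGroupSubalgebra p (FreeProP p n) := fun U V h => by
    refine MonoidAlgebra.ext (Finsupp.ext fun q => ?_)
    refine congrFun (denseRange_ofFree.equalizer (hcont (coeffAt q ∘ₗ
      (MonoidAlgebra.mapDomainAlgHom ℤ_[p] ℤ_[p] (openQuotientMap h)).toLinearMap))
      (hcont (coeffAt q)) (funext fun w => ?_)) x
    change coeffAt q (MonoidAlgebra.mapDomainRingHom _ (openQuotientMap h) (D (ofFree p n w) U)) =
      coeffAt q (D (ofFree p n w) V)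
    rw [hD, hD, levelFox, map_discreteFox, levelFox,
      show freeToQuotient V = (openQuotientMap h).comp (freeToQuotient U) from rfl,
      discreteFox_comp]
    congr 2
    exact MonoidHom.ext fun x => by simp
  refine ⟨fun x => ⟨D x, hmem x⟩, CompleteGroupAlgebra.continuous_iff_coord.2 fun U q => hf U q,
    fun j => CompleteGroupAlgebra.ext_proj fun U => ?_, fun x y =>
    CompleteGroupAlgebra.ext_proj fun U => ?_⟩
  · change D (gen p j) U = _
    rw [← ofFree_of, hD, levelFox, discreteFox_of]
    split_ifs <;> simp
  · change D (x * y) U = D x U + MonoidAlgebra.of ℤ_[p] _ (QuotientGroup.mk x) * D y U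
    refine MonoidAlgebra.ext (Finsupp.ext fun q => ?_)
    have hlin (x : FreeProP p n) : Continuous fun y =>
        coeffAt q (D x U + MonoidAlgebra.of ℤ_[p] _ (QuotientGroup.mk x) * D y U) :=
      continuous_const.add (hcont (coeffAt q ∘ₗ LinearMap.mulLeft ℤ_[p]
        (MonoidAlgebra.of ℤ_[p] (FreeProP p n ⧸ U.toSubgroup) (QuotientGroup.mk x))))
    have hquot : Continuous fun x : FreeProP p n =>
        coeffAt q (MonoidAlgebra.of ℤ_[p] _ (QuotientGroup.mk (s := U.toSubgroup) x) * D y U) := by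
      have := QuotientGroup.discreteTopology U.isOpen'
      exact (continuous_of_discreteTopology (f := fun c : FreeProP p n ⧸ U.toSubgroup =>
        coeffAt q (MonoidAlgebra.of ℤ_[p] _ c * D y U))).comp QuotientGroup.continuous_mk
    -- The product rule is extended one variable at a time: first `y` becomes arbitrary while the
    -- left factor stays in the free group, then the left factor.
    have hfree (a : FreeGroup (Fin n)) : coeffAt q (D (ofFree p n a * y) U) = coeffAt q
        (D (ofFree p n a) U + MonoidAlgebra.of ℤ_[p] _ (QuotientGroup.mk (ofFree p n a)) * D y U) :=
      congrFun (denseRange_ofFree.equalizer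
        ((hcont (coeffAt q)).comp (continuous_const_mul (ofFree p n a))) (hlin (ofFree p n a))
        (funext fun b => by
          simp only [Function.comp_apply, ← map_mul, hD]
          rw [levelFox, discreteFox_mul]
          rfl)) y
    exact congrFun (denseRange_ofFree.equalizer
      ((hcont (coeffAt q)).comp (continuous_mul_const y)) ((hcont (coeffAt q)).add hquot)
      (funext hfree)) x

end FreeProP

/-! ### Functionals on `Q̄_p ⊗ ℤ_p[[Γ]]` -/

section Coefficients

variable {p : ℕ} [Fact p.Prime]

instance PadicAlgCl.instContinuousSMul : ContinuousSMul ℤ_[p] (PadicAlgCl p) where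
  continuous_smul := by
    have : (fun x : ℤ_[p] × PadicAlgCl p => x.1 • x.2) = fun x => (x.1 : ℚ_[p]) • x.2 :=
      funext fun x => (IsScalarTower.algebraMap_smul ℚ_[p] x.1 x.2).symm
    rw [this]
    exact ((continuous_subtype_val (p := fun x : ℚ_[p] => ‖x‖ ≤ 1)).comp continuous_fst).smul continuous_snd

/-- Finitely generated `ℤ_p`-submodules of `Q̄_p` are therefore free, which
`IwasawaTensor.eq_zero_of_coord` needs. -/
instance PadicAlgCl.instIsTorsionFree : Module.IsTorsionFree ℤ_[p] (PadicAlgCl p) := by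
  have : FaithfulSMul ℤ_[p] (PadicAlgCl p) := by
    rw [faithfulSMul_iff_algebraMap_injective, IsScalarTower.algebraMap_eq ℤ_[p] ℚ_[p]]
    exact (algebraMap ℚ_[p] (PadicAlgCl p)).injective.comp
      (IsFractionRing.injective ℤ_[p] ℚ_[p])
  infer_instance

namespace IwasawaTensor

/-- The `Q̄_p`-valued coordinate functionals on `Q̄_p ⊗ ℤ_p[[Γ]]`. -/
def coord (U : OpenNormalSubgroup (Gam p)) (c : Gam p ⧸ U.toSubgroup) :
    IwasawaTensor p →ₗ[ℤ_[p]] PadicAlgCl p :=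
  (TensorProduct.rid ℤ_[p] (PadicAlgCl p)).toLinearMap ∘ₗ
    LinearMap.lTensor (PadicAlgCl p) (CompleteGroupAlgebra.coord U c)

@[simp] theorem coord_tmul (U : OpenNormalSubgroup (Gam p)) (c : Gam p ⧸ U.toSubgroup)
    (e : PadicAlgCl p) (b : CompleteGroupAlgebra p (Gam p)) :
    coord U c (e ⊗ₜ b) = CompleteGroupAlgebra.coord U c b • e := by
  simp [coord]

/-- A tensor lives over a finitely generated, hence free, submodule `N` of `Q̄_p`. In a basis of `N`
the vanishing of all coordinate functionals says that each coefficient in `ℤ_p[[Γ]]` has zero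
coordinates. -/
theorem eq_zero_of_coord {x : IwasawaTensor p} (h : ∀ U c, coord U c x = 0) : x = 0 := by
  obtain ⟨N, hN, hx⟩ := TensorProduct.exists_finite_submodule_left_of_setFinite {x}
    (Set.finite_singleton x)
  obtain ⟨y, rfl⟩ := hx rfl
  let b := Module.Free.chooseBasis ℤ_[p] N
  obtain ⟨d, rfl⟩ := TensorProduct.eq_repr_basis_left b y
  suffices d = 0 by simp [this]
  refine Finsupp.ext fun j => CompleteGroupAlgebra.ext_coord fun U c => ?_
  have hUc := h U c
  rw [Finsupp.sum_fintype _ _ (by simp), map_sum, map_sum] at hUc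
  simp only [LinearMap.rTensor_tmul, coord_tmul, Submodule.subtype_apply] at hUc
  have hN0 : ∑ i, CompleteGroupAlgebra.coord U c (d i) • b i = 0 :=
    Subtype.ext (by simpa using hUc)
  simpa using Fintype.linearIndependent_iff.1 b.linearIndependent _ hN0 j

theorem ext_coord {x y : IwasawaTensor p} (h : ∀ U c, coord U c x = coord U c y) : x = y :=
  sub_eq_zero.1 (eq_zero_of_coord fun U c => by rw [map_sub, h, sub_self])

end IwasawaTensor

/-! ### Calculus of continuous maps into `Q̄_p ⊗ ℤ_p[[Γ]]` -/

namespace ContinuousIntoTensor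

variable {X : Type*} [TopologicalSpace X] {f g : X → IwasawaTensor p}

theorem of_fintype {ι : Type*} [Fintype ι] (e : ι → PadicAlgCl p)
    {c : ι → X → CompleteGroupAlgebra p (Gam p)} (hc : ∀ i, Continuous (c i)) :
    ContinuousIntoTensor fun x => ∑ i, e i ⊗ₜ[ℤ_[p]] c i x :=
  ⟨Fintype.card ι, e ∘ (Fintype.equivFin ι).symm, c ∘ (Fintype.equivFin ι).symm, fun _ => hc _,
    fun x => ((Fintype.equivFin ι).symm.sum_comp fun i => e i ⊗ₜ[ℤ_[p]] c i x).symm⟩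

theorem continuous_coord (hf : ContinuousIntoTensor f) (U : OpenNormalSubgroup (Gam p))
    (c : Gam p ⧸ U.toSubgroup) : Continuous fun x => IwasawaTensor.coord U c (f x) := by
  obtain ⟨s, e, b, hb, hfb⟩ := hf
  simp only [hfb, map_sum, IwasawaTensor.coord_tmul]
  exact continuous_finsetSum _ fun i _ =>
    ((CompleteGroupAlgebra.continuous_coord U c).comp (hb i)).smul continuous_const

theorem add (hf : ContinuousIntoTensor f) (hg : ContinuousIntoTensor g) :
    ContinuousIntoTensor fun x => f x + g x := by
  obtain ⟨s, e, b, hb, hfb⟩ := hf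
  obtain ⟨s', e', b', hb', hgb⟩ := hg
  have := of_fintype (Sum.elim e e') (c := Sum.elim b b') (Sum.rec hb hb')
  simpa [hfb, hgb] using this

theorem zero : ContinuousIntoTensor fun _ : X => (0 : IwasawaTensor p) :=
  ⟨0, 0, 0, fun i => i.elim0, fun _ => by simp⟩

theorem sum {ι : Type*} {s : Finset ι} {f : ι → X → IwasawaTensor p}
    (hf : ∀ i, ContinuousIntoTensor (f i)) : ContinuousIntoTensor fun x => ∑ i ∈ s, f i x := by
  classical
  induction s using Finset.induction_on with
  | empty => simpa using zero
  | insert i s hi ih => simpa [Finset.sum_insert hi] using (hf i).add ih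

theorem const_mul (t : IwasawaTensor p) (hf : ContinuousIntoTensor f) :
    ContinuousIntoTensor fun x => t * f x := by
  induction t using TensorProduct.induction_on with
  | zero => simpa using zero
  | add a b ha hb => simpa [add_mul] using ha.add hb
  | tmul a b =>
    obtain ⟨s, e, c, hc, hfc⟩ := hf
    refine ⟨s, fun i => a * e i, fun i x => b * c i x,
      fun i => (CompleteGroupAlgebra.continuous_const_mul b).comp (hc i), fun x => ?_⟩
    simp [hfc, Finset.mul_sum]

theorem mul_const (t : IwasawaTensor p) (hf : ContinuousIntoTensor f) :
    ContinuousIntoTensor fun x => f x * t := by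
  simpa [mul_comm] using hf.const_mul t

theorem comp {Y : Type*} [TopologicalSpace Y] (hf : ContinuousIntoTensor f) {h : Y → X}
    (hh : Continuous h) : ContinuousIntoTensor fun y => f (h y) := by
  obtain ⟨s, e, b, hb, hfb⟩ := hf
  exact ⟨s, e, fun i y => b i (h y), fun i => (hb i).comp hh, fun y => hfb (h y)⟩

/-- Two continuous linear maps from `ℤ_p[[H]]` to `Q̄_p ⊗ ℤ_p[[Γ]]` agree if they agree on `H`. -/
theorem linearMap_ext_of {H : Type*} [Group H] [TopologicalSpace H] [IsTopologicalGroup H]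
    [CompactSpace H] {L L' : CompleteGroupAlgebra p H →ₗ[ℤ_[p]] IwasawaTensor p}
    (hL : ContinuousIntoTensor L) (hL' : ContinuousIntoTensor L')
    (h : ∀ x, L (CompleteGroupAlgebra.of p x) = L' (CompleteGroupAlgebra.of p x)) : L = L' := by
  refine LinearMap.ext fun z => IwasawaTensor.ext_coord fun U c => ?_
  -- No topology on the tensor product is needed: the coordinate functionals separate points and
  -- reduce the claim to the Hausdorff space `Q̄_p`.
  exact LinearMap.congr_fun (CompleteGroupAlgebra.linearMap_ext_of
    (L := IwasawaTensor.coord U c ∘ₗ L) (L' := IwasawaTensor.coord U c ∘ₗ L')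
    (hL.continuous_coord U c) (hL'.continuous_coord U c)
    fun x => congrArg (IwasawaTensor.coord U c) (h x)) z

end ContinuousIntoTensor

/-! ### Existence of the extension of the twist to the complete group algebra -/

namespace CompleteGroupAlgebra

variable {H H' : Type*} [Group H] [TopologicalSpace H] [Group H'] [TopologicalSpace H']
  [IsTopologicalGroup H']

theorem continuous_of : Continuous (of p : H' → CompleteGroupAlgebra p H') := by
  refine continuous_iff_coord.2 fun U c => ?_
  have := QuotientGroup.discreteTopology U.isOpen'
  exact (continuous_of_discreteTopology (f := fun q : H' ⧸ U.toSubgroup =>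
    (MonoidAlgebra.single q (1 : ℤ_[p])).coeff c)).comp QuotientGroup.continuous_mk

variable [CompactSpace H'] [IsTopologicalGroup H] [CompactSpace H] [TotallyDisconnectedSpace H]

/-- Integration of `f(x) χ(x)` with values in a complete group algebra. -/
theorem exists_twistedIntegral (χ : H →ₜ* H') {f : H → ℤ_[p]} (hf : Continuous f) :
    ∃ L : CompleteGroupAlgebra p H →ₗ[ℤ_[p]] CompleteGroupAlgebra p H',
      Continuous L ∧ ∀ x, L (of p x) = f x • of p (χ x) := by
  have hg (V : OpenNormalSubgroup H') (q : H' ⧸ V.toSubgroup) :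
      Continuous fun x => coord V q (f x • of p (χ x)) := by
    simp only [map_smul]
    exact hf.smul ((continuous_coord V q).comp (continuous_of.comp χ.continuous_toFun))
  choose I hI hIof using fun V q => exists_integral (hg V q)
  have := fun V : OpenNormalSubgroup H' => Fintype.ofFinite (H' ⧸ V.toSubgroup)
  let T (V : OpenNormalSubgroup H') :
      CompleteGroupAlgebra p H →ₗ[ℤ_[p]] MonoidAlgebra ℤ_[p] (H' ⧸ V.toSubgroup) :=
    (MonoidAlgebra.coeffLinearEquiv ℤ_[p]).symm.toLinearMap ∘ₗ
      (Finsupp.linearEquivFunOnFinite ℤ_[p] ℤ_[p] _).symm.toLinearMap ∘ₗ LinearMap.pi (I V)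
  have hT (V z q) : (T V z).coeff q = I V q z := rfl
  have hTof (V x) : T V (of p x) = proj p V (f x • of p (χ x)) :=
    MonoidAlgebra.ext (Finsupp.ext fun q => hIof V q x)
  have hTsum (V z) : T V z = ∑ q, I V q z • MonoidAlgebra.single q (1 : ℤ_[p]) := by
    classical
    refine MonoidAlgebra.ext (Finsupp.ext fun q => ?_)
    simp [hT, Finsupp.single_apply]
  -- Both sides of the compatibility condition are continuous and linear in `z` and agree on group
  -- elements, which span a dense submodule.
  have hmem (z) : (fun V => T V z) ∈ completeGroupSubalgebra p H' := fun V W h => by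
    refine MonoidAlgebra.ext (Finsupp.ext fun q => ?_)
    let κ : MonoidAlgebra ℤ_[p] (H' ⧸ W.toSubgroup) →ₗ[ℤ_[p]] ℤ_[p] :=
      Finsupp.lapply q ∘ₗ (MonoidAlgebra.coeffLinearEquiv ℤ_[p]).toLinearMap
    let L := κ ∘ₗ (MonoidAlgebra.mapDomainAlgHom ℤ_[p] ℤ_[p] (openQuotientMap h)).toLinearMap ∘ₗ T V
    have hL : Continuous L := by
      have : (L : _ → ℤ_[p]) = fun z => ∑ q, I V q z • κ (MonoidAlgebra.mapDomainAlgHom ℤ_[p] ℤ_[p]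
          (openQuotientMap h) (MonoidAlgebra.single q (1 : ℤ_[p]))) := by
        funext z
        simp only [L, LinearMap.comp_apply, hTsum, map_sum, map_smul, AlgHom.toLinearMap_apply]
      rw [this]
      exact continuous_finsetSum _ fun q _ => (hI V q).smul continuous_const
    refine LinearMap.congr_fun (linearMap_ext_of (L := L) (L' := I W q) hL (hI W q) fun x => ?_) z
    rw [hIof]
    change κ (MonoidAlgebra.mapDomainAlgHom ℤ_[p] ℤ_[p] (openQuotientMap h) (T V (of p x))) = _
    rw [hTof]
    exact congrArg κ (mapDomain_proj h _)
  exact ⟨{ toFun := fun z => ⟨fun V => T V z, hmem z⟩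
           map_add' := fun z w => ext_proj fun V => map_add (T V) z w
           map_smul' := fun c z => ext_proj fun V => map_smul (T V) c z },
    continuous_iff_coord.2 fun V q => hI V q, fun x => ext_proj fun V => hTof V x⟩

end CompleteGroupAlgebra

/-! ### Finiteness of the coefficients of a representation of the free pro-`p` group -/

namespace FreeProP

variable {n l : ℕ}

/-- A representation of `F_n` over `Q̄_p` is defined over a finite extension of `ℚ_p`. -/
theorem exists_finiteDimensional_coefficients (φ : FreeProP p n →ₜ* GL (Fin l) (PadicAlgCl p)) :
    ∃ E : Submodule ℚ_[p] (PadicAlgCl p), FiniteDimensional ℚ_[p] E ∧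
      ∀ x s t, (φ x : Matrix (Fin l) (Fin l) (PadicAlgCl p)) s t ∈ E := by
  let entries (g : GL (Fin l) (PadicAlgCl p)) : Set (PadicAlgCl p) :=
    Set.range fun st : Fin l × Fin l => (g : Matrix (Fin l) (Fin l) (PadicAlgCl p)) st.1 st.2
  let S : Set (PadicAlgCl p) :=
    ⋃ i : Fin n, entries (φ (gen p i)) ∪ entries (φ (gen p i)⁻¹)
  have : Finite S := Set.finite_iUnion fun i => (Set.finite_range _).union (Set.finite_range _)
  let E := IntermediateField.adjoin ℚ_[p] S
  have hE : FiniteDimensional ℚ_[p] E := IntermediateField.finiteDimensional_adjoin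
    fun x _ => Algebra.IsIntegral.isIntegral x
  have hgen (i) : ∀ s t, (φ (gen p i) : Matrix (Fin l) (Fin l) (PadicAlgCl p)) s t ∈ E ∧
      (φ (gen p i)⁻¹ : Matrix (Fin l) (Fin l) (PadicAlgCl p)) s t ∈ E := fun s t =>
    ⟨IntermediateField.subset_adjoin _ _ (Set.mem_iUnion.2 ⟨i, .inl ⟨(s, t), rfl⟩⟩),
      IntermediateField.subset_adjoin _ _ (Set.mem_iUnion.2 ⟨i, .inr ⟨(s, t), rfl⟩⟩)⟩
  have hfree (w : FreeGroup (Fin n)) : ∀ s t,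
      (φ (ofFree p n w) : Matrix (Fin l) (Fin l) (PadicAlgCl p)) s t ∈ E ∧
      (φ (ofFree p n w)⁻¹ : Matrix (Fin l) (Fin l) (PadicAlgCl p)) s t ∈ E := by
    induction w using FreeGroup.induction_on with
    | C1 =>
      have (s t : Fin l) : (1 : Matrix (Fin l) (Fin l) (PadicAlgCl p)) s t ∈ E := by
        rw [Matrix.one_apply]
        split_ifs
        exacts [one_mem E, zero_mem E]
      simp [this]
    | of i => exact hgen i
    | inv_of i hi =>
      intro s t
      rw [map_inv, inv_inv]
      exact (hi s t).symm
    | mul x y hx hy =>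
      intro s t
      simp only [map_mul, mul_inv_rev, Units.val_mul, Matrix.mul_apply]
      exact ⟨sum_mem fun u _ => mul_mem (hx _ _).1 (hy _ _).1,
        sum_mem fun u _ => mul_mem (hy _ _).2 (hx _ _).2⟩
  have hfin : FiniteDimensional ℚ_[p] (Subalgebra.toSubmodule E.toSubalgebra) := hE
  refine ⟨Subalgebra.toSubmodule E.toSubalgebra, hfin, fun x s t => ?_⟩
  -- Finite-dimensional subspaces over the complete field `ℚ_p` are closed, so the condition passes
  -- from the free group to its closure.
  have hclosed : IsClosed {x : FreeProP p n |
      (φ x : Matrix (Fin l) (Fin l) (PadicAlgCl p)) s t ∈ Subalgebra.toSubmodule E.toSubalgebra} :=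
    (Submodule.closed_of_finiteDimensional _).preimage
      ((Units.continuous_val.comp φ.continuous_toFun).matrix_elem s t)
  exact denseRange_ofFree.induction_on x hclosed fun w => (hfree w s t).1

end FreeProP

/-- A continuous function on a compact space with values in a finite-dimensional `ℚ_p`-subspace
of `Q̄_p` has continuous `ℤ_p`-valued coordinates. -/
theorem exists_padicInt_coordinates {X : Type*} [TopologicalSpace X] [CompactSpace X]
    {f : X → PadicAlgCl p} (hf : Continuous f) (E : Submodule ℚ_[p] (PadicAlgCl p))
    [FiniteDimensional ℚ_[p] E] (hE : ∀ x, f x ∈ E) :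
    ∃ (d : ℕ) (e : Fin d → PadicAlgCl p) (c : Fin d → X → ℤ_[p]),
      (∀ i, Continuous (c i)) ∧ ∀ x, f x = ∑ i, c i x • e i := by
  let b := Module.finBasis ℚ_[p] E
  let g (i) (x : X) : ℚ_[p] := b.coord i ⟨f x, hE x⟩
  have hg (i) : Continuous (g i) :=
    (LinearMap.continuous_of_finiteDimensional (b.coord i)).comp (hf.subtype_mk hE)
  -- Compactness bounds the `ℚ_p`-coordinates. A common factor `p ^ N` makes them integral and is
  -- compensated by dividing the basis vectors by it.
  have hbound : ∃ N : ℕ, ∀ i x, ‖(p : ℚ_[p]) ^ N * g i x‖ ≤ 1 := by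
    have h1 (i) : ∃ C, ∀ x, ‖g i x‖ ≤ C := by
      obtain ⟨C, hC⟩ := (isCompact_range (hg i)).isBounded.exists_norm_le
      exact ⟨C, fun x => hC _ ⟨x, rfl⟩⟩
    choose C hC using h1
    obtain ⟨C', hC'⟩ : ∃ C', ∀ i, C i ≤ C' :=
      ⟨∑ i, |C i|, fun i => (le_abs_self _).trans
        (Finset.single_le_sum (f := fun i => |C i|) (fun _ _ => abs_nonneg _) (Finset.mem_univ i))⟩
    obtain ⟨N, hN⟩ := pow_unbounded_of_one_lt C' (Nat.one_lt_cast (α := ℝ).2 (Fact.out : p.Prime).one_lt)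
    refine ⟨N, fun i x => ?_⟩
    have hp : (0 : ℝ) < (p : ℝ) ^ N := pow_pos (Nat.cast_pos.2 (Fact.out : p.Prime).pos) _
    rw [norm_mul, norm_pow, Padic.norm_p, inv_pow, inv_mul_le_iff₀ hp, mul_one]
    exact ((hC i x).trans (hC' i)).trans hN.le
  obtain ⟨N, hN⟩ := hbound
  have hp0 : ((p : ℚ_[p]) ^ N) ≠ 0 :=
    pow_ne_zero _ (Nat.cast_ne_zero.2 (Fact.out : p.Prime).ne_zero)
  let c (i) (x : X) : ℤ_[p] := ⟨(p : ℚ_[p]) ^ N * g i x, hN i x⟩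
  refine ⟨_, fun i => ((p : ℚ_[p]) ^ N)⁻¹ • (b i : PadicAlgCl p), c, fun i =>
    Continuous.subtype_mk (p := fun y : ℚ_[p] => ‖y‖ ≤ 1) (continuous_const.mul (hg i)) (hN i),
    fun x => ?_⟩
  have h1 : f x = ∑ i, g i x • (b i : PadicAlgCl p) := by
    have := congrArg (Submodule.subtype E) (b.sum_repr ⟨f x, hE x⟩)
    rw [map_sum] at this
    exact this.symm
  rw [h1]
  refine Finset.sum_congr rfl fun i _ => ?_
  rw [← IsScalarTower.algebraMap_smul ℚ_[p] (c i x), smul_smul]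
  congr 1
  change _ = (p : ℚ_[p]) ^ N * g i x * _
  field_simp

/-! ### The twist as an algebra homomorphism on `ℤ_p[[F]]` -/

section Twist

variable {F : Type*} [Group F] [TopologicalSpace F] {l : ℕ}

theorem twist_one (φ : F →ₜ* GL (Fin l) (PadicAlgCl p)) (χ : F →ₜ* Gam p) : twist φ χ 1 = 1 := by
  ext s t
  simp only [twist, map_one, Units.val_one, Matrix.map_apply, Matrix.one_apply]
  split_ifs
  exacts [rfl, TensorProduct.zero_tmul _ _]

theorem twist_mul (φ : F →ₜ* GL (Fin l) (PadicAlgCl p)) (χ : F →ₜ* Gam p) (x y : F) :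
    twist φ χ (x * y) = twist φ χ x * twist φ χ y := by
  ext s t
  simp [twist, Matrix.mul_apply, TensorProduct.sum_tmul]

variable [IsTopologicalGroup F] [CompactSpace F] [TotallyDisconnectedSpace F]

/-- Each matrix entry of `φ` is a finite combination of continuous `ℤ_p`-valued functions, so each
entry of the twist can be integrated. Multiplicativity holds on group elements and spreads by
density, one factor at a time. -/
theorem exists_completeTwist (φ : F →ₜ* GL (Fin l) (PadicAlgCl p)) (χ : F →ₜ* Gam p)
    (E : Submodule ℚ_[p] (PadicAlgCl p)) [FiniteDimensional ℚ_[p] E]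
    (hE : ∀ x s t, (φ x : Matrix (Fin l) (Fin l) (PadicAlgCl p)) s t ∈ E) :
    ∃ Φ : CompleteGroupAlgebra p F →ₐ[ℤ_[p]] Matrix (Fin l) (Fin l) (IwasawaTensor p),
      (∀ x, Φ (CompleteGroupAlgebra.of p x) = twist φ χ x) ∧
      ∀ s t, ContinuousIntoTensor fun z => Φ z s t := by
  have hφ (s t) : Continuous fun x => (φ x : Matrix (Fin l) (Fin l) (PadicAlgCl p)) s t :=
    (Units.continuous_val.comp φ.continuous_toFun).matrix_elem s t
  have hentry (s t) : ∃ L : CompleteGroupAlgebra p F →ₗ[ℤ_[p]] IwasawaTensor p,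
      ContinuousIntoTensor L ∧ ∀ x, L (CompleteGroupAlgebra.of p x) = twist φ χ x s t := by
    obtain ⟨d, e, c, hc, hce⟩ := exists_padicInt_coordinates (hφ s t) E fun x => hE x s t
    choose I hI hIof using fun i => CompleteGroupAlgebra.exists_twistedIntegral χ (hc i)
    refine ⟨∑ i, TensorProduct.mk ℤ_[p] _ _ (e i) ∘ₗ I i,
      ⟨d, e, fun i z => I i z, hI, fun z => by simp⟩, fun x => ?_⟩
    simp [hIof, twist, hce, TensorProduct.sum_tmul, TensorProduct.smul_tmul]
  choose L hL hLof using hentry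
  let Φ : CompleteGroupAlgebra p F →ₗ[ℤ_[p]] Matrix (Fin l) (Fin l) (IwasawaTensor p) :=
    { toFun := fun z => Matrix.of fun s t => L s t z
      map_add' := fun z w => by ext s t; simp
      map_smul' := fun c z => by ext s t; simp }
  have hΦof (x) : Φ (CompleteGroupAlgebra.of p x) = twist φ χ x := by
    ext s t
    exact hLof s t x
  have hΦ (s t) : ContinuousIntoTensor fun z => Φ z s t := hL s t
  let entry (s t : Fin l) : Matrix (Fin l) (Fin l) (IwasawaTensor p) →ₗ[ℤ_[p]] IwasawaTensor p :=
    Matrix.entryLinearMap ℤ_[p] _ s t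
  have hmul_of (z x) : Φ (z * CompleteGroupAlgebra.of p x) =
      Φ z * Φ (CompleteGroupAlgebra.of p x) := by
    ext s t
    refine LinearMap.congr_fun (ContinuousIntoTensor.linearMap_ext_of
      (L := entry s t ∘ₗ Φ ∘ₗ LinearMap.mulRight ℤ_[p] (CompleteGroupAlgebra.of p x))
      (L' := entry s t ∘ₗ LinearMap.mulRight ℤ_[p] (Φ (CompleteGroupAlgebra.of p x)) ∘ₗ Φ)
      ((hΦ s t).comp (CompleteGroupAlgebra.continuous_mul_const _)) ?_ fun y => ?_) z
    · change ContinuousIntoTensor fun z => (Φ z * Φ (CompleteGroupAlgebra.of p x)) s t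
      simp only [Matrix.mul_apply]
      exact ContinuousIntoTensor.sum fun u => (hΦ s u).mul_const _
    · change entry s t (Φ (_ * _)) = entry s t (Φ _ * Φ _)
      rw [← map_mul, hΦof, hΦof, hΦof, twist_mul]
  have hmul (z w) : Φ (z * w) = Φ z * Φ w := by
    ext s t
    refine LinearMap.congr_fun (ContinuousIntoTensor.linearMap_ext_of
      (L := entry s t ∘ₗ Φ ∘ₗ LinearMap.mulLeft ℤ_[p] z)
      (L' := entry s t ∘ₗ LinearMap.mulLeft ℤ_[p] (Φ z) ∘ₗ Φ)
      ((hΦ s t).comp (CompleteGroupAlgebra.continuous_const_mul _)) ?_ fun y => ?_) w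
    · change ContinuousIntoTensor fun w => (Φ z * Φ w) s t
      simp only [Matrix.mul_apply]
      exact ContinuousIntoTensor.sum fun u => (hΦ u t).const_mul _
    · exact congrArg (entry s t) (hmul_of z y)
  exact ⟨AlgHom.ofLinearMap Φ (by rw [← map_one (CompleteGroupAlgebra.of p), hΦof, twist_one]) hmul,
    hΦof, hΦ⟩

end Twist

end Coefficients

/-! ### Existence of the evaluation at `γ = a` -/

section Evaluation

open Filter Topology

variable {p : ℕ} [Fact p.Prime]

/-- For `‖a - 1‖ < 1` there is a continuous character `t ↦ a ^ t` of `ℤ_p` with values in a finite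
extension of `ℚ_p`. -/
theorem exists_continuous_addChar {a : PadicAlgCl p} (ha : ‖a - 1‖ < 1) :
    ∃ (E : Submodule ℚ_[p] (PadicAlgCl p)) (κ : AddChar ℤ_[p] (PadicAlgCl p)),
      FiniteDimensional ℚ_[p] E ∧ Continuous κ ∧ κ 1 = a ∧ ∀ t, κ t ∈ E := by
  let E := IntermediateField.adjoin ℚ_[p] {a}
  have hfin : FiniteDimensional ℚ_[p] E := IntermediateField.finiteDimensional_adjoin
    fun x _ => Algebra.IsIntegral.isIntegral x
  -- The character is constructed over the finite extension `ℚ_p(a)`, because the construction needs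
  -- a complete field.
  have : CompleteSpace E := FiniteDimensional.complete ℚ_[p] E
  have hbdd : IsBoundedSMul ℤ_[p] E := IsBoundedSMul.of_norm_smul_le fun c x => by
    rw [← IsScalarTower.algebraMap_smul ℚ_[p] c x, norm_smul]
    rfl
  have : IsUltrametricDist E := inferInstance
  let x : E := ⟨a - 1, sub_mem (IntermediateField.mem_adjoin_simple_self _ a) (one_mem _)⟩
  have hx : ‖x‖ < 1 := ha
  let κ := (PadicInt.continuousAddCharEquiv_of_norm_mul p E).symm ⟨x, hx⟩
  have hκ1 : κ.1 1 - 1 = x :=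
    congrArg Subtype.val ((PadicInt.continuousAddCharEquiv_of_norm_mul p E).apply_symm_apply ⟨x, hx⟩)
  refine ⟨Subalgebra.toSubmodule E.toSubalgebra,
    { toFun := fun t => (κ.1 t : PadicAlgCl p)
      map_zero_eq_one' := by rw [AddChar.map_zero_eq_one]; rfl
      map_add_eq_mul' := fun s t => by rw [AddChar.map_add_eq_mul]; rfl },
    hfin, continuous_subtype_val.comp κ.2, ?_, fun t => (κ.1 t).2⟩
  have := congrArg (Subtype.val : E → PadicAlgCl p) (sub_eq_iff_eq_add.1 hκ1)
  simpa [x] using this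

/-- Evaluation at `a` exists if `γ` is a topological generator. -/
theorem exists_evaluation {γ : Gam p} (hγ : IsUnit γ.toAdd) {a : PadicAlgCl p} (ha : ‖a - 1‖ < 1) :
    ∃ ev : IwasawaTensor p →ₐ[PadicAlgCl p] PadicAlgCl p,
      Continuous (fun c : CompleteGroupAlgebra p (Gam p) => ev (1 ⊗ₜ[ℤ_[p]] c)) ∧
      ev (1 ⊗ₜ[ℤ_[p]] CompleteGroupAlgebra.of p γ) = a := by
  obtain ⟨E, κ, hE, hκ, hκ1, hκE⟩ := exists_continuous_addChar ha
  obtain ⟨u, hu⟩ := hγ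
  -- Dividing by the unit `u = γ` turns the normalisation `κ 1 = a` into `χ γ = a`.
  let χ (x : Gam p) : PadicAlgCl p := κ (x.toAdd * (u⁻¹ : ℤ_[p]ˣ))
  have hχ : Continuous χ := hκ.comp (continuous_toAdd.mul continuous_const)
  have hχmul (x y) : χ (x * y) = χ x * χ y := by
    simp only [χ, toAdd_mul, add_mul, AddChar.map_add_eq_mul]
  have hχγ : χ γ = a := by simp only [χ, ← hu, Units.mul_inv, hκ1]
  obtain ⟨d, e, c, hc, hce⟩ := exists_padicInt_coordinates hχ E fun x => hκE _
  choose I hI hIof using fun i => CompleteGroupAlgebra.exists_integral (hc i)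
  let L : CompleteGroupAlgebra p (Gam p) →ₗ[ℤ_[p]] PadicAlgCl p :=
    ∑ i, (I i).smulRight (e i)
  have hL : Continuous L := by
    have : (L : _ → PadicAlgCl p) = fun z => ∑ i, I i z • e i := by
      funext z
      simp [L]
    rw [this]
    exact continuous_finsetSum _ fun i _ => (hI i).smul continuous_const
  have hLof (x) : L (CompleteGroupAlgebra.of p x) = χ x := by simp [L, hIof, hce]
  have hmul_of (z x) : L (z * CompleteGroupAlgebra.of p x) =
      L z * L (CompleteGroupAlgebra.of p x) := by
    refine LinearMap.congr_fun (CompleteGroupAlgebra.linearMap_ext_of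
      (L := L ∘ₗ LinearMap.mulRight ℤ_[p] (CompleteGroupAlgebra.of p x))
      (L' := LinearMap.mulRight ℤ_[p] (L (CompleteGroupAlgebra.of p x)) ∘ₗ L)
      (hL.comp (CompleteGroupAlgebra.continuous_mul_const _)) (hL.mul continuous_const)
      fun y => ?_) z
    change L (_ * _) = L _ * L _
    rw [← map_mul, hLof, hLof, hLof, hχmul]
  have hmul (z w) : L (z * w) = L z * L w :=
    LinearMap.congr_fun (CompleteGroupAlgebra.linearMap_ext_of
      (L := L ∘ₗ LinearMap.mulLeft ℤ_[p] z) (L' := LinearMap.mulLeft ℤ_[p] (L z) ∘ₗ L)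
      (hL.comp (CompleteGroupAlgebra.continuous_const_mul _)) (continuous_const.mul hL)
      fun y => hmul_of z y) w
  have hone : L 1 = 1 := by
    rw [← map_one (CompleteGroupAlgebra.of p), hLof]
    simp [χ]
  let ev : IwasawaTensor p →ₐ[PadicAlgCl p] PadicAlgCl p :=
    Algebra.TensorProduct.lift (AlgHom.id _ _) (AlgHom.ofLinearMap L hone hmul)
      fun _ _ => Commute.all _ _
  have hev (z) : ev (1 ⊗ₜ[ℤ_[p]] z) = L z := by simp [ev]
  exact ⟨ev, by simpa only [hev] using hL, by rw [hev, hLof, hχγ]⟩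

/-- If all free generators have the same image under a continuous surjection `F_n → ℤ_p`, this image
is a topological generator. -/
theorem FreeProP.isUnit_of_surjective {n : ℕ} {χ : FreeProP p n →ₜ* Gam p}
    (hχ : Function.Surjective χ) {γ : Gam p} (hγ : ∀ i, χ (FreeProP.gen p i) = γ) :
    IsUnit γ.toAdd := by
  obtain ⟨x, hx⟩ := hχ (.ofAdd 1)
  -- The set `γ ℤ_p` is compact, hence closed, and contains the image of the free group. By density
  -- it contains the whole image, in particular `1`.
  have hclosed : IsClosed {x | (χ x).toAdd ∈ Set.range fun t : ℤ_[p] => γ.toAdd * t} :=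
    (isCompact_range (continuous_const.mul continuous_id)).isClosed.preimage
      (continuous_toAdd.comp χ.continuous_toFun)
  have hfree (w : FreeGroup (Fin n)) :
      (χ (ofFree p n w)).toAdd ∈ Set.range fun t : ℤ_[p] => γ.toAdd * t := by
    induction w using FreeGroup.induction_on with
    | C1 => exact ⟨0, by simp⟩
    | of i => exact ⟨1, by simp [← hγ i, FreeProP.ofFree_of]⟩
    | inv_of i _ => exact ⟨-1, by simp [← hγ i, FreeProP.ofFree_of]⟩
    | mul x y hx hy =>
      obtain ⟨s, hs⟩ := hx
      obtain ⟨t, ht⟩ := hy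
      exact ⟨s + t, by simp only [map_mul, toAdd_mul, ← hs, ← ht, mul_add]⟩
  have hmem : (χ x).toAdd ∈ Set.range fun t : ℤ_[p] => γ.toAdd * t :=
    denseRange_ofFree.induction_on x hclosed hfree
  obtain ⟨t, ht⟩ := hmem
  rw [hx] at ht
  exact IsUnit.of_mul_eq_one t ht

end Evaluation

/-! ### Minors and rank -/

/-- Choose `s` independent rows among the rows of `A`; the resulting matrix has rank `s`, so it has
`s` independent columns, and the square matrix so cut out is invertible. -/
theorem Matrix.exists_submatrix_det_ne_zero {K ι κ : Type*} [Field K] [Fintype ι] [Fintype κ]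
    (A : Matrix ι κ K) {s : ℕ} (hs : s ≤ A.rank) :
    ∃ (f : Fin s ↪ ι) (g : Fin s ↪ κ), (A.submatrix f g).det ≠ 0 := by
  obtain ⟨f, hf⟩ : ∃ f : Fin s → ι, LinearIndependent K fun i => A.row (f i) := by
    rw [Matrix.rank_eq_finrank_span_row] at hs
    obtain ⟨b, hb, -, hli⟩ := Submodule.exists_fun_fin_finrank_span_eq K (Set.range A.row)
    choose f hf using hb
    refine ⟨f ∘ Fin.castLE hs, ?_⟩
    simp only [Function.comp_apply, hf]
    exact hli.comp _ (Fin.castLE_injective hs)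
  have hrank : (A.submatrix f id).rank = s := by
    have : LinearIndependent K (A.submatrix f id).row := hf
    simpa using this.rank_matrix
  obtain ⟨g, hg⟩ : ∃ g : Fin s → κ, LinearIndependent K fun i => (A.submatrix f id).col (g i) := by
    rw [Matrix.rank_eq_finrank_span_cols] at hrank
    obtain ⟨b, hb, -, hli⟩ := Submodule.exists_fun_fin_finrank_span_eq K (Set.range (A.submatrix f id).col)
    choose g hg using hb
    refine ⟨g ∘ Fin.cast hrank.symm, ?_⟩
    simp only [Function.comp_apply, hg]
    exact hli.comp _ (Fin.cast_injective _)
  refine ⟨⟨f, fun i j h => hf.injective (by simp only [h])⟩,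
    ⟨g, fun i j h => hg.injective (by simp only [h])⟩, ?_⟩
  have : LinearIndependent K (A.submatrix f g).col := hg
  rw [Matrix.linearIndependent_cols_iff_isUnit, Matrix.isUnit_iff_isUnit_det] at this
  exact this.ne_zero

/-! ### Cocycles on a pro-`p` group from its presentation -/

/-- A continuous cocycle on a compact group that vanishes on relators vanishes on the closed normal
subgroup that they generate. -/
theorem IsProPPresentation.cocycle_eq_zero {p n m l : ℕ} {K : Type*} [Field K] [TopologicalSpace K]
    [IsTopologicalRing K] [T2Space K] {r : Fin m → FreeProP p n}
    {G : Type*} [Group G] [TopologicalSpace G] [T2Space G]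
    {π : FreeProP p n →ₜ* G} (hπ : IsProPPresentation r π) (ρ : G →ₜ* GL (Fin l) K)
    {β : FreeProP p n → Fin l → K} (hβ : Continuous β)
    (hmul : ∀ x y, β (x * y) = β x + (ρ (π x) : Matrix (Fin l) (Fin l) K).mulVec (β y))
    (hr : ∀ j, β (r j) = 0) {x : FreeProP p n} (hx : π x = 1) : β x = 0 := by
  have hone : β 1 = 0 := by simpa using hmul 1 1
  -- On the kernel of `π` the action is trivial and `β` is additive, so imposing `π x = 1` makes the
  -- zero set of `β` a subgroup.
  let Z : Subgroup (FreeProP p n) :=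
    { carrier := {x | π x = 1 ∧ β x = 0}
      one_mem' := ⟨map_one π, hone⟩
      mul_mem' := fun {x y} hx hy => ⟨by rw [map_mul, hx.1, hy.1, one_mul], by
        rw [hmul, hx.2, hy.2, Matrix.mulVec_zero, add_zero]⟩
      inv_mem' := fun {x} hx => ⟨by rw [map_inv, hx.1, inv_one], by
        have := hmul x x⁻¹
        rwa [mul_inv_cancel, hone, hx.1, hx.2, map_one, Units.val_one, Matrix.one_mulVec, zero_add,
          eq_comm] at this⟩ }
  have hZ : Z.Normal := ⟨fun x hx g => ⟨by rw [map_mul, map_mul, hx.1, mul_one, ← map_mul,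
      mul_inv_cancel, map_one], by
    rw [hmul, hmul, hx.2, Matrix.mulVec_zero, add_zero, map_mul, hx.1, mul_one, ← hmul,
      mul_inv_cancel, hone]⟩⟩
  have hclosed : IsClosed (Z : Set (FreeProP p n)) :=
    (isClosed_eq π.continuous_toFun continuous_const).inter (isClosed_eq hβ continuous_const)
  have hsub : (Subgroup.normalClosure (Set.range r) : Set (FreeProP p n)) ⊆ Z := by
    refine Subgroup.normalClosure_le_normal ?_
    rintro _ ⟨j, rfl⟩
    refine ⟨?_, hr j⟩
    change r j ∈ {x | π x = 1}
    rw [hπ.ker_eq]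
    exact subset_closure (Subgroup.subset_normalClosure ⟨j, rfl⟩)
  have hx' : x ∈ {x | π x = 1} := hx
  rw [hπ.ker_eq] at hx'
  exact (closure_minimal hsub hclosed hx').2

/-- A continuous cocycle on the free pro-`p` group that vanishes on the relators descends. -/
theorem IsProPPresentation.descend_mem_contCocycles {p n m l : ℕ} [Fact p.Prime]
    {K : Type*} [Field K] [TopologicalSpace K]
    [IsTopologicalRing K] [T2Space K] {r : Fin m → FreeProP p n}
    {G : Type*} [Group G] [TopologicalSpace G] [T2Space G]
    {π : FreeProP p n →ₜ* G} (hπ : IsProPPresentation r π) (ρ : G →ₜ* GL (Fin l) K)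
    {β : FreeProP p n → Fin l → K} (hβ : Continuous β)
    (hmul : ∀ x y, β (x * y) = β x + (ρ (π x) : Matrix (Fin l) (Fin l) K).mulVec (β y))
    (hr : ∀ j, β (r j) = 0) :
    (fun y => β (Function.surjInv hπ.surjective y)) ∈ contCocycles ρ ∧
      ∀ x, β (Function.surjInv hπ.surjective (π x)) = β x := by
  have hfib (x x') (h : π x = π x') : β x' = β x := by
    have hker : π (x⁻¹ * x') = 1 := by rw [map_mul, map_inv, h, inv_mul_cancel]
    have := hmul x (x⁻¹ * x')
    rwa [mul_inv_cancel_left, hπ.cocycle_eq_zero ρ hβ hmul hr hker, Matrix.mulVec_zero,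
      add_zero] at this
  have hσ (x) : β (Function.surjInv hπ.surjective (π x)) = β x :=
    hfib _ _ (Function.surjInv_eq hπ.surjective _).symm
  -- A continuous surjection from a compact space to a Hausdorff space is a quotient map, so
  -- continuity on `G` can be tested on `F_n`.
  have hquot : Topology.IsQuotientMap π :=
    π.continuous_toFun.isClosedMap.isQuotientMap π.continuous_toFun hπ.surjective
  refine ⟨⟨hquot.continuous_iff.2 (by simpa only [Function.comp_def, hσ] using hβ), fun x y => ?_⟩, hσ⟩
  obtain ⟨x, rfl⟩ := hπ.surjective x
  obtain ⟨y, rfl⟩ := hπ.surjective y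
  simp only [← map_mul, hσ, hmul]

/-- The linear map sending a vector to its coboundary. -/
def coboundaryMap {K : Type*} [Field K] [TopologicalSpace K]
    [IsTopologicalRing K] {G : Type*} [Group G] [TopologicalSpace G] {l : ℕ}
    (ρ : G →ₜ* GL (Fin l) K) : (Fin l → K) →ₗ[K] (G → Fin l → K) where
  toFun v x := (ρ x : Matrix (Fin l) (Fin l) K).mulVec v - v
  map_add' v w := by
    funext x
    simp only [Matrix.mulVec_add, Pi.add_apply]
    abel
  map_smul' c v := by
    funext x
    simp only [Matrix.mulVec_smul, Pi.smul_apply, RingHom.id_apply, smul_sub]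

/-- If `Z¹` contains a subspace of dimension greater than the degree of `ρ`, then `H¹ ≠ 0`. -/
theorem nontrivial_contH1_of_injective {K : Type*} [Field K] [TopologicalSpace K]
    [IsTopologicalRing K] {G : Type*} [Group G] [TopologicalSpace G] {l : ℕ}
    (ρ : G →ₜ* GL (Fin l) K) {V : Type*} [AddCommGroup V] [Module K V]
    (Ψ : V →ₗ[K] (G → Fin l → K)) (hΨ : Function.Injective Ψ) (hmem : ∀ v, Ψ v ∈ contCocycles ρ)
    (hdim : l < Module.finrank K V) : Nontrivial (ContH1 ρ) := by
  by_contra hne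
  rw [not_nontrivial_iff_subsingleton, Submodule.Quotient.subsingleton_iff] at hne
  -- If `H¹` vanished, the image of `V` would consist of coboundaries, which form a space of
  -- dimension at most `l`.
  have hle : LinearMap.range Ψ ≤ LinearMap.range (coboundaryMap ρ) := by
    rintro _ ⟨v, rfl⟩
    have : (⟨Ψ v, hmem v⟩ : contCocycles ρ) ∈
      (contCoboundaries ρ).submoduleOf (contCocycles ρ) := hne ▸ trivial
    obtain ⟨w, hw⟩ := this.2
    exact ⟨w, (funext hw).symm⟩
  have h1 := Submodule.finrank_mono hle
  rw [LinearMap.finrank_range_of_inj hΨ] at h1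
  have h2 := LinearMap.finrank_range_le (coboundaryMap ρ)
  rw [Module.finrank_fin_fun] at h2
  omega

/-! ### The Fox calculus and the specialised presentation matrix -/

section Specialization

variable {p : ℕ} [Fact p.Prime] {n m l : ℕ}

/-- `FreeProP.exists_foxDerivative` rules out the default value `0`, and any chosen witness
satisfies these rules; `completeTwist_spec` plays the same role for the twist. -/
theorem foxDerivative_spec (i : Fin n) :
    Continuous (foxDerivative p i) ∧
      (∀ j, foxDerivative p i (FreeProP.gen p j) = if j = i then 1 else 0) ∧
      ∀ x y, foxDerivative p i (x * y) =
        foxDerivative p i x + CompleteGroupAlgebra.of p x * foxDerivative p i y := by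
  classical
  have h : ∃ D : FreeProP p n → CompleteGroupAlgebra p (FreeProP p n), Continuous D ∧
      (∀ j, D (FreeProP.gen p j) = if j = i then 1 else 0) ∧
      ∀ x y, D (x * y) = D x + CompleteGroupAlgebra.of p x * D y := FreeProP.exists_foxDerivative i
  have heq : foxDerivative p i = h.choose := by
    rw [foxDerivative]
    convert dif_pos h
  rw [heq]
  exact h.choose_spec

theorem completeTwist_spec (φ : FreeProP p n →ₜ* GL (Fin l) (PadicAlgCl p))
    (χ : FreeProP p n →ₜ* Gam p) :
    ∃ Φ : CompleteGroupAlgebra p (FreeProP p n) →ₐ[ℤ_[p]] Matrix (Fin l) (Fin l) (IwasawaTensor p),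
      completeTwist φ χ = Φ ∧ (∀ x, Φ (CompleteGroupAlgebra.of p x) = twist φ χ x) ∧
      ∀ s t, ContinuousIntoTensor fun z => Φ z s t := by
  obtain ⟨E, hE, hφE⟩ := FreeProP.exists_finiteDimensional_coefficients φ
  have h := exists_completeTwist φ χ E hφE
  refine ⟨h.choose, ?_, h.choose_spec⟩
  rw [completeTwist, dif_pos h]

theorem ContinuousIntoTensor.continuous_algHom {X : Type*} [TopologicalSpace X]
    {f : X → IwasawaTensor p} (hf : ContinuousIntoTensor f)
    (ev : IwasawaTensor p →ₐ[PadicAlgCl p] PadicAlgCl p)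
    (hev : Continuous fun c : CompleteGroupAlgebra p (Gam p) => ev (1 ⊗ₜ[ℤ_[p]] c)) :
    Continuous fun x => ev (f x) := by
  obtain ⟨s, e, c, hc, hfc⟩ := hf
  have h (i x) : ev (e i ⊗ₜ[ℤ_[p]] c i x) = e i * ev (1 ⊗ₜ[ℤ_[p]] c i x) := by
    rw [← smul_eq_mul, ← map_smul, TensorProduct.smul_tmul', smul_eq_mul, mul_one]
  simp only [hfc, map_sum, h]
  exact continuous_finsetSum _ fun i _ => continuous_const.mul (hev.comp (hc i))

/-- The cocycle on `F_n` with prescribed values on the free generators, expressed by the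
specialised Fox derivatives. -/
def foxCocycle (φ : FreeProP p n →ₜ* GL (Fin l) (PadicAlgCl p)) (χ : FreeProP p n →ₜ* Gam p)
    (ev : IwasawaTensor p →ₐ[PadicAlgCl p] PadicAlgCl p) :
    (Fin n × Fin l → PadicAlgCl p) →ₗ[PadicAlgCl p] (FreeProP p n → Fin l → PadicAlgCl p) where
  toFun v x s := ∑ it : Fin n × Fin l, ev (completeTwist φ χ (foxDerivative p it.1 x) s it.2) * v it
  map_add' v w := by
    funext x s
    simp [mul_add, Finset.sum_add_distrib]
  map_smul' c v := by
    funext x s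
    simp [Finset.mul_sum, mul_left_comm]

variable (φ : FreeProP p n →ₜ* GL (Fin l) (PadicAlgCl p)) (χ : FreeProP p n →ₜ* Gam p)
  (ev : IwasawaTensor p →ₐ[PadicAlgCl p] PadicAlgCl p)

theorem foxCocycle_apply (v : Fin n × Fin l → PadicAlgCl p) (x : FreeProP p n) (s : Fin l) :
    foxCocycle φ χ ev v x s = ∑ it : Fin n × Fin l,
      ev (completeTwist φ χ (foxDerivative p it.1 x) s it.2) * v it := rfl

theorem continuous_foxCocycle
    (hev : Continuous fun c : CompleteGroupAlgebra p (Gam p) => ev (1 ⊗ₜ[ℤ_[p]] c))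
    (v : Fin n × Fin l → PadicAlgCl p) : Continuous (foxCocycle φ χ ev v) := by
  obtain ⟨Φ, hΦ, -, hcont⟩ := completeTwist_spec φ χ
  refine continuous_pi fun s => ?_
  simp only [foxCocycle_apply, hΦ]
  exact continuous_finsetSum _ fun it _ => (((hcont s it.2).comp
    (foxDerivative_spec it.1).1).continuous_algHom ev hev).mul continuous_const

/-- Since `∂g_j/∂g_i = δ_{ij}`, the cocycle takes the prescribed values on the generators; this
gives the injectivity of `v ↦ foxCocycle φ χ ev v`. -/
theorem foxCocycle_gen (v : Fin n × Fin l → PadicAlgCl p) (j : Fin n) (s : Fin l) :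
    foxCocycle φ χ ev v (FreeProP.gen p j) s = v (j, s) := by
  obtain ⟨Φ, hΦ, -, -⟩ := completeTwist_spec φ χ
  rw [foxCocycle_apply, Finset.sum_eq_single (j, s)]
  · simp [(foxDerivative_spec (p := p) j).2.1, hΦ]
  · rintro ⟨i, t⟩ - hne
    rw [(foxDerivative_spec i).2.1, hΦ]
    split_ifs with hji
    · rw [map_one, Matrix.one_apply_ne (by rintro rfl; exact hne (by rw [hji])), map_zero, zero_mul]
    · rw [map_zero, Matrix.zero_apply, map_zero, zero_mul]
  · simp

/-- The Fox product rule becomes the cocycle identity after the two homomorphisms, the extended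
twist and then `ev`, are applied. -/
theorem foxCocycle_mul (v : Fin n × Fin l → PadicAlgCl p) (x y : FreeProP p n) :
    foxCocycle φ χ ev v (x * y) =
      foxCocycle φ χ ev v x + ((twist φ χ x).map ev).mulVec (foxCocycle φ χ ev v y) := by
  obtain ⟨Φ, hΦ, hof, -⟩ := completeTwist_spec φ χ
  funext s
  simp only [Pi.add_apply, Matrix.mulVec, dotProduct, foxCocycle_apply, Finset.mul_sum,
    Matrix.map_apply]
  rw [Finset.sum_comm, ← Finset.sum_add_distrib]
  refine Finset.sum_congr rfl fun it _ => ?_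
  rw [(foxDerivative_spec it.1).2.2, hΦ, map_add, map_mul, hof, Matrix.add_apply, map_add,
    Matrix.mul_apply, map_sum, add_mul, Finset.sum_mul]
  simp only [map_mul, mul_assoc]

theorem foxCocycle_relator (r : Fin m → FreeProP p n) (v : Fin n × Fin l → PadicAlgCl p)
    (j : Fin m) (s : Fin l) :
    foxCocycle φ χ ev v (r j) s = ((foxMatrix r φ χ).map ev).mulVec v (j, s) := rfl

/-- If `ev` kills the Fitting ideal of level `d`, then the corank of the specialised matrix
exceeds `d`. -/
theorem lt_finrank_ker_of_fittingIdeal {R K : Type*} [CommRing R] [Field K] {ι κ : Type*}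
    [Fintype ι] [Fintype κ] (Q : Matrix ι κ R) (d : ℕ) (ev : R →+* K)
    (h : ∀ x ∈ fittingIdeal Q d, ev x = 0) :
    d < Module.finrank K (LinearMap.ker (Q.map ev).mulVecLin) := by
  classical
  -- The truncated subtraction is harmless: if `d` is at least the number of columns, the empty
  -- minor `1` lies in the ideal and cannot be sent to `0`.
  have hrank : (Q.map ev).rank < Fintype.card κ - d := by
    by_contra hlt
    obtain ⟨f, g, hfg⟩ := (Q.map ev).exists_submatrix_det_ne_zero (not_lt.1 hlt)
    refine hfg ?_
    rw [← h _ (Ideal.subset_span ⟨f, g, rfl⟩), RingHom.map_det]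
    rfl
  have := (Q.map ev).mulVecLin.finrank_range_add_finrank_ker
  rw [Module.finrank_fintype_fun_eq_card] at this
  change (Q.map ev).rank + _ = _ at this
  omega

end Specialization

end

/-! ### The dimension count for `H¹` -/

theorem theorem4p1 (p : ℕ) [Fact p.Prime] (k n m : ℕ) (hk : 2 ≤ k)
    (r : Fin m → FreeProP p n)
    {G : Type*} [Group G] [TopologicalSpace G] [IsTopologicalGroup G] [T2Space G]
    (π : FreeProP p n →ₜ* G) (hπ : IsProPPresentation r π)
    (α : G →ₜ* Gam p) (hα : Function.Surjective α)
    (γ : Gam p) (hγ : ∀ i, α (π (FreeProP.gen p i)) = γ)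
    (φ : FreeProP p n →ₜ* GL (Fin (k - 1)) (PadicAlgCl p))
    (a : PadicAlgCl p) (ha : ‖a - 1‖ < 1)
    (ρ : G →ₜ* GL (Fin (k - 1)) (PadicAlgCl p))
    (hρ : ∀ x, (ρ (π x) : Matrix (Fin (k - 1)) (Fin (k - 1)) (PadicAlgCl p)) =
      (twist φ (α.comp π) x).map (evalAt γ a))
    (Δ : IwasawaTensor p) (hΔ : IsTwistedAlexander r φ (α.comp π) (k - 1) Δ)
    (hzero : evalAt γ a Δ = 0) :
    Nontrivial (ContH1 ρ) := by
  have hunit : IsUnit γ.toAdd :=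
    FreeProP.isUnit_of_surjective (χ := α.comp π) (hα.comp hπ.surjective) hγ
  obtain ⟨ev, hev, hevcont⟩ : ∃ ev : IwasawaTensor p →ₐ[PadicAlgCl p] PadicAlgCl p,
      evalAt γ a = ev ∧
        Continuous fun c : CompleteGroupAlgebra p (Gam p) => ev (1 ⊗ₜ[ℤ_[p]] c) := by
    have h := exists_evaluation hunit ha
    exact ⟨h.choose, by rw [evalAt, dif_pos h], h.choose_spec.1⟩
  set χ := α.comp π
  simp only [hev] at hρ hzero
  have hmul (v x y) : foxCocycle φ χ ev v (x * y) = foxCocycle φ χ ev v x +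
      (ρ (π x) : Matrix (Fin (k - 1)) (Fin (k - 1)) (PadicAlgCl p)).mulVec
        (foxCocycle φ χ ev v y) := by
    rw [hρ, foxCocycle_mul]
  let Q := (foxMatrix r φ χ).map (ev : IwasawaTensor p →+* PadicAlgCl p)
  have hrel (v : LinearMap.ker Q.mulVecLin) (j) : foxCocycle φ χ ev v (r j) = 0 :=
    funext fun s => (foxCocycle_relator φ χ ev r v j s).trans
      (congrFun (LinearMap.mem_ker.1 v.2) (j, s))
  have hdesc (v : LinearMap.ker Q.mulVecLin) :=
    hπ.descend_mem_contCocycles ρ (continuous_foxCocycle φ χ ev hevcont v) (hmul v) (hrel v)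
  refine nontrivial_contH1_of_injective ρ
    (LinearMap.funLeft (PadicAlgCl p) (Fin (k - 1) → PadicAlgCl p)
      (Function.surjInv hπ.surjective) ∘ₗ foxCocycle φ χ ev ∘ₗ (LinearMap.ker Q.mulVecLin).subtype)
    (fun v w hvw => Subtype.ext (funext fun js => ?_)) (fun v => (hdesc v).1)
    (lt_finrank_ker_of_fittingIdeal _ _ _ fun x hx => ?_)
  -- Evaluating the two descended cocycles at the images of the generators recovers the entries of
  -- `v` and `w`.
  · have := congrFun (congrFun hvw (π (FreeProP.gen p js.1))) js.2
    change foxCocycle φ χ ev v (Function.surjInv hπ.surjective _) _ =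
      foxCocycle φ χ ev w (Function.surjInv hπ.surjective _) _ at this
    rwa [(hdesc v).2, (hdesc w).2, foxCocycle_gen, foxCocycle_gen] at this
  -- Taking the divisor to be `Δ` itself in the gcd property shows that `Δ` divides every element of
  -- the Fitting ideal.
  · obtain ⟨c, rfl⟩ := (hΔ Δ).1 dvd_rfl x hx
    change ev (Δ * c) = 0
    rw [map_mul, hzero, zero_mul]
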